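/- Let $C=\{0,1\}^{\infty}$ be the Cantor set. For finite words $\alpha,\beta\in\{0,1\}^*$ let $I(\alpha)\subseteq C$ be the set of infinite sequences with prefix $\alpha$; the sets $R(\alpha,\beta)=I(\alpha)\times I(\beta)$ are the dyadic rectangles of $C^2$. The Brin–Thompson group $2V$ is the group of all homeomorphisms $f$ of $C^2$ for which there is a partition of $C^2$ into finitely many dyadic rectangles such that on each rectangle $R(\alpha,\beta)$ of the partition $f$ is a prefix replacement, $f(\alpha\psi,\beta\omega)=(\gamma\psi,\delta\omega)$ for some words $\gamma,\delta$ and all $\psi,\omega\in C$. A point $(\psi,\omega)\in C^2$ is dyadic if $\psi$ and $\omega$ each have only finitely many $1$'s. An element $f\in 2V$ is given to an algorithm by a numbered pattern pair, that is, by a finite list of quadruples of words $(\alpha_i,\beta_i,\gamma_i,\delta_i)$ such that the $R(\alpha_i,\beta_i)$ partition $C^2$, the $R(\gamma_i,\delta_i)$ partition $C^2$, and $f(\alpha_i\psi,\beta_i\omega)=(\gamma_i\psi,\delta_i\omega)$ for all $i,\psi,\omega$; a dyadic point is given by words $u,v$ with $p=(u000\cdots,v000\cdots)$, and a dyadic rectangle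 $R(\alpha,\beta)$ by the words $\alpha,\beta$. **Theorem.** It is not decidable, given an element $f\in 2V$, a dyadic point $p\in C^2$ and a dyadic rectangle $R\subseteq C^2$, whether the orbit of $p$ under $f$ contains a point of $R$: there is no algorithm (partial recursive function) that, on every description of such a triple $(f,p,R)$, halts and correctly answers this question. This holds both for the forward orbit $\{f^n(p): n\ge 0\}$ and for the full orbit $\{f^n(p): n\in\mathbb{Z}\}$. -/

import Mathlib

namespace BrinThompson

/-- The Cantor set, identified with the infinite product space `{0,1}^∞`. -/
abbrev Cantor : Type := ℕ → Bool

/-- Finite sequences of `0`s and `1`s. -/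
abbrev Word : Type := List Bool

/-- Put one digit in front of an infinite sequence. -/
def cons (b : Bool) (ψ : Cantor) : Cantor
  | 0 => b
  | n + 1 => ψ n

/-- The concatenation `αψ` of a finite sequence with an infinite sequence. -/
def cat : Word → Cantor → Cantor
  | [], ψ => ψ
  | b :: α, ψ => cons b (cat α ψ)

/-- The dyadic interval `I(α)` of all infinite sequences with prefix `α`. -/
def interval (α : Word) : Set Cantor := {x | ∃ ψ, x = cat α ψ}

/-- The rectangle `R(α, β) = I(α) × I(β)`. -/
def rect (α β : Word) : Set (Cantor × Cantor) := interval α ×ˢ interval β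

/-- `R` is a dyadic rectangle in the square of the Cantor set. -/
def IsDyadicRectangle (R : Set (Cantor × Cantor)) : Prop :=
  ∃ α β : Word, R = rect α β

/-- A dyadic subdivision: a partition of `C²` into finitely many dyadic rectangles. -/
def IsDyadicSubdivision (D : Set (Set (Cantor × Cantor))) : Prop :=
  D.Finite ∧ (∀ R ∈ D, IsDyadicRectangle R) ∧ Setoid.IsPartition D

/-- On `R(α, β)` the map `f` is the prefix replacement onto `R(γ, δ)`. -/
def IsPrefixReplacement (f : Cantor × Cantor → Cantor × Cantor) (α β γ δ : Word) : Prop :=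
  ∀ ψ ω : Cantor, f (cat α ψ, cat β ω) = (cat γ ψ, cat δ ω)

/-- `f` acts as a prefix replacement on the dyadic rectangle `R`. -/
def ActsAsPrefixReplacementOn (f : Cantor × Cantor → Cantor × Cantor)
    (R : Set (Cantor × Cantor)) : Prop :=
  ∃ α β γ δ : Word, R = rect α β ∧ IsPrefixReplacement f α β γ δ

/-- The defining property of elements of `2V`. -/
def IsTwoV (f : (Cantor × Cantor) ≃ₜ (Cantor × Cantor)) : Prop :=
  ∃ D, IsDyadicSubdivision D ∧ ∀ R ∈ D, ActsAsPrefixReplacementOn f R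

/-! Facts needed to see that these homeomorphisms form a group. -/

theorem cat_append (α β : Word) (ψ : Cantor) : cat (α ++ β) ψ = cat α (cat β ψ) := by
  induction α with
  | nil => rfl
  | cons b α ih => simp [cat, ih]

theorem cons_inj {b c : Bool} {ψ ω : Cantor} (h : cons b ψ = cons c ω) : b = c ∧ ψ = ω :=
  ⟨congrFun h 0, funext fun n => congrFun h (n + 1)⟩

theorem exists_append_of_cat_eq : ∀ (α u : Word) (ψ ω : Cantor), α.length ≤ u.length →
    cat u ω = cat α ψ → ∃ x, u = α ++ x ∧ ψ = cat x ω
  | [], u, _, _, _, h => ⟨u, rfl, h.symm⟩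
  | _ :: _, [], _, _, hl, _ => by simp at hl
  | a :: α, b :: u, ψ, ω, hl, h => by
    obtain ⟨h1, h2⟩ := cons_inj h
    obtain ⟨x, rfl, hx⟩ := exists_append_of_cat_eq α u ψ ω (by simpa using hl) h2
    exact ⟨x, by simp [h1], hx⟩

theorem exists_cat_eq (N : ℕ) (ψ : Cantor) : ∃ u : Word, u.length = N ∧ ∃ ω, ψ = cat u ω := by
  induction N generalizing ψ with
  | zero => exact ⟨[], rfl, ψ, rfl⟩
  | succ N ih =>
    obtain ⟨u, hu, ω, h⟩ := ih (fun n => ψ (n + 1))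
    refine ⟨ψ 0 :: u, by simp [hu], ω, ?_⟩
    funext n
    cases n with
    | zero => rfl
    | succ n => exact congrFun h n

theorem eq_of_cat_eq {u v : Word} {ψ ω : Cantor} (hl : u.length = v.length)
    (h : cat u ψ = cat v ω) : u = v := by
  obtain ⟨x, rfl, -⟩ := exists_append_of_cat_eq v u ω ψ hl.ge h
  simpa using hl

theorem mem_rect {α β : Word} {ψ ω : Cantor} : (cat α ψ, cat β ω) ∈ rect α β :=
  ⟨⟨ψ, rfl⟩, ⟨ω, rfl⟩⟩

theorem isTwoV_iff (f : (Cantor × Cantor) ≃ₜ (Cantor × Cantor)) :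
    IsTwoV f ↔ ∃ N : ℕ, ∀ u v : Word, u.length = N → v.length = N →
      ∃ γ δ, IsPrefixReplacement f u v γ δ := by
  constructor
  · rintro ⟨D, ⟨hfin, -, hpart⟩, hD⟩
    choose! a b c d hR hf using hD
    obtain ⟨N, hN⟩ := (hfin.image fun R => max (a R).length (b R).length).bddAbove
    refine ⟨N, fun u v hu hv => ?_⟩
    obtain ⟨R, ⟨hRD, hmem⟩, -⟩ := hpart.2 (cat u fun _ => false, cat v fun _ => false)
    have hle : max (a R).length (b R).length ≤ N := hN ⟨R, hRD, rfl⟩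
    rw [hR R hRD] at hmem
    obtain ⟨⟨ψ, hψ⟩, ⟨ω, hω⟩⟩ := hmem
    obtain ⟨x, hx, -⟩ := exists_append_of_cat_eq (a R) u _ _ (by omega) hψ
    obtain ⟨y, hy, -⟩ := exists_append_of_cat_eq (b R) v _ _ (by omega) hω
    refine ⟨c R ++ x, d R ++ y, fun ψ ω => ?_⟩
    rw [hx, hy, cat_append, cat_append, hf R hRD, cat_append, cat_append]
  · rintro ⟨N, hN⟩
    refine ⟨{R | ∃ u v : Word, u.length = N ∧ v.length = N ∧ R = rect u v}, ⟨?_, ?_, ?_, ?_⟩, ?_⟩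
    · have hf := List.finite_length_eq Bool N
      refine ((hf.prod hf).image fun p => rect p.1 p.2).subset ?_
      rintro R ⟨u, v, hu, hv, rfl⟩
      exact ⟨(u, v), ⟨hu, hv⟩, rfl⟩
    · rintro R ⟨u, v, -, -, rfl⟩
      exact ⟨u, v, rfl⟩
    · rintro ⟨u, v, -, -, h⟩
      have : (cat u fun _ => false, cat v fun _ => false) ∈ rect u v := mem_rect
      rw [← h] at this
      exact this
    · rintro ⟨ψ, ω⟩
      obtain ⟨u, hu, ψ', rfl⟩ := exists_cat_eq N ψ
      obtain ⟨v, hv, ω', rfl⟩ := exists_cat_eq N ω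
      refine ⟨rect u v, ⟨⟨u, v, hu, hv, rfl⟩, mem_rect⟩, ?_⟩
      rintro R ⟨⟨u', v', hu', hv', rfl⟩, ⟨⟨x, hx⟩, ⟨y, hy⟩⟩⟩
      rw [eq_of_cat_eq (hu.trans hu'.symm) hx, eq_of_cat_eq (hv.trans hv'.symm) hy]
    · rintro R ⟨u, v, hu, hv, rfl⟩
      obtain ⟨γ, δ, h⟩ := hN u v hu hv
      exact ⟨u, v, γ, δ, rfl, h⟩

theorem image_rect {f : (Cantor × Cantor) ≃ₜ (Cantor × Cantor)} {α β γ δ : Word}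
    (h : IsPrefixReplacement f α β γ δ) : f '' rect α β = rect γ δ := by
  ext ⟨x, y⟩
  constructor
  · rintro ⟨⟨_, _⟩, ⟨⟨ψ, rfl⟩, ⟨ω, rfl⟩⟩, he⟩
    rw [h ψ ω] at he
    rw [← he]
    exact mem_rect
  · rintro ⟨⟨ψ, rfl⟩, ⟨ω, rfl⟩⟩
    exact ⟨_, mem_rect, h ψ ω⟩

/-- The Brin-Thompson group `2V`, as a group of homeomorphisms of `C²`. -/
def TwoV : Subgroup ((Cantor × Cantor) ≃ₜ (Cantor × Cantor)) where
  carrier := {f | IsTwoV f}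
  one_mem' := (isTwoV_iff 1).2 ⟨0, fun u v _ _ => ⟨u, v, fun _ _ => rfl⟩⟩
  mul_mem' := by
    intro f g hf hg
    obtain ⟨M, hM⟩ := (isTwoV_iff f).1 hf
    obtain ⟨N, hN⟩ := (isTwoV_iff g).1 hg
    refine (isTwoV_iff (f * g)).2 ⟨N + M, fun u v hu hv => ?_⟩
    obtain ⟨γ, δ, h1⟩ := hN (u.take N) (v.take N) (by simp [hu]) (by simp [hv])
    have aux : ∀ w x : Word, x.length = M → ((w ++ x).take M).length = M := by
      intro w x hx
      simp [hx]
    obtain ⟨γ', δ', h2⟩ := hM ((γ ++ u.drop N).take M) ((δ ++ v.drop N).take M)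
      (aux _ _ (by simp [hu])) (aux _ _ (by simp [hv]))
    refine ⟨γ' ++ (γ ++ u.drop N).drop M, δ' ++ (δ ++ v.drop N).drop M, fun ψ ω => ?_⟩
    change f (g (cat u ψ, cat v ω)) = _
    rw [← List.take_append_drop N u, ← List.take_append_drop N v, cat_append, cat_append, h1,
      ← cat_append, ← cat_append, List.take_append_drop, List.take_append_drop,
      ← List.take_append_drop M (γ ++ u.drop N), ← List.take_append_drop M (δ ++ v.drop N),
      cat_append, cat_append, h2, List.take_append_drop, List.take_append_drop,
      cat_append, cat_append]
  inv_mem' := by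
    rintro f ⟨D, ⟨hfin, -, hpart⟩, hD⟩
    refine ⟨(fun R => f '' R) '' D, ⟨hfin.image _, ?_, ?_, ?_⟩, ?_⟩
    · rintro _ ⟨R, hR, rfl⟩
      obtain ⟨α, β, γ, δ, rfl, h⟩ := hD R hR
      exact ⟨γ, δ, image_rect h⟩
    · rintro ⟨R, hR, h⟩
      rw [Set.image_eq_empty.1 h] at hR
      exact hpart.1 hR
    · intro p
      obtain ⟨R, ⟨hR, hp⟩, hu⟩ := hpart.2 (f.symm p)
      refine ⟨f '' R, ⟨⟨R, hR, rfl⟩, ⟨_, hp, f.apply_symm_apply p⟩⟩, ?_⟩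
      rintro _ ⟨⟨S, hS, rfl⟩, ⟨q, hq, rfl⟩⟩
      rw [hu S ⟨hS, by simpa using hq⟩]
    · rintro _ ⟨R, hR, rfl⟩
      obtain ⟨α, β, γ, δ, rfl, h⟩ := hD R hR
      refine ⟨γ, δ, α, β, image_rect h, fun ψ ω => ?_⟩
      change f.symm _ = _
      rw [← h, f.symm_apply_apply]

/-- A point of `C²` is dyadic if both coordinates have only finitely many `1`s. -/
def IsDyadicPoint (p : Cantor × Cantor) : Prop :=
  {n | p.1 n = true}.Finite ∧ {n | p.2 n = true}.Finite

/-! ### Finite descriptions of the inputs -/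

/-- A numbered list of pairs of words `((α, β), (γ, δ))`, the `i`-th entry giving the `i`-th
rectangle `R(α, β)` of the domain pattern and the `i`-th rectangle `R(γ, δ)` of the range
pattern. -/
abbrev PatternPair : Type := List ((Word × Word) × (Word × Word))

/-- The (domain or range) rectangles of the list are distinct and form a dyadic subdivision. -/
def IsNumberedPattern (L : List (Word × Word)) : Prop :=
  (L.map fun w => rect w.1 w.2).Nodup ∧
    IsDyadicSubdivision {R | R ∈ L.map fun w => rect w.1 w.2}

/-- `P` is a numbered pattern pair for `f`. -/
def IsPatternPairFor (P : PatternPair) (f : (Cantor × Cantor) ≃ₜ (Cantor × Cantor)) : Prop :=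
  IsNumberedPattern (P.map Prod.fst) ∧ IsNumberedPattern (P.map Prod.snd) ∧
    ∀ e ∈ P, IsPrefixReplacement f e.1.1 e.1.2 e.2.1 e.2.2

/-- The pair of words `(u, v)` specifies the point `(u000…, v000…)`. -/
def IsCodeOfPoint (w : Word × Word) (p : Cantor × Cantor) : Prop :=
  p = (cat w.1 fun _ => false, cat w.2 fun _ => false)

/-- The pair of words `(α, β)` specifies the rectangle `R(α, β)`. -/
def IsCodeOfRectangle (w : Word × Word) (R : Set (Cantor × Cantor)) : Prop :=
  R = rect w.1 w.2

/-- An instance of the problem: `f ∈ 2V`, a dyadic point and a dyadic rectangle. -/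
structure Input where
  f : (Cantor × Cantor) ≃ₜ (Cantor × Cantor)
  p : Cantor × Cantor
  R : Set (Cantor × Cantor)
  f_mem : f ∈ TwoV
  p_dyadic : IsDyadicPoint p
  R_dyadic : IsDyadicRectangle R

/-- What an algorithm is given: a numbered pattern pair, and words for the point and for the
rectangle. -/
abbrev InputCode : Type := PatternPair × (Word × Word) × (Word × Word)

/-- The code `c` specifies the input `x`. -/
def IsCodeOf (c : InputCode) (x : Input) : Prop :=
  IsPatternPairFor c.1 x.f ∧ IsCodeOfPoint c.2.1 x.p ∧ IsCodeOfRectangle c.2.2 x.R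

/-- A property of inputs is decidable if some algorithm (a partial recursive function on codes),
given any code of any input, halts and answers correctly whether the input has the property.
Nothing is required of the algorithm on codes that specify no input. -/
def IsDecidable (Q : Input → Prop) : Prop :=
  ∃ d : InputCode →. Bool, Partrec d ∧
    ∀ (c : InputCode) (x : Input), IsCodeOf c x → ∃ b ∈ d c, (b = true ↔ Q x)

/-- The forward orbit `p, f p, f² p, …`. -/
def forwardOrbit (f : (Cantor × Cantor) ≃ₜ (Cantor × Cantor)) (p : Cantor × Cantor) :
    Set (Cantor × Cantor) := {q | ∃ n : ℕ, q = (f ^ n) p}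

/-- The full orbit of `p` under the cyclic group generated by `f`. -/
def fullOrbit (f : (Cantor × Cantor) ≃ₜ (Cantor × Cantor)) (p : Cantor × Cantor) :
    Set (Cantor × Cantor) := {q | ∃ n : ℤ, q = (f ^ n) p}

end BrinThompson

namespace BrinThompson

/-! The halting problem is reduced to orbit questions for one fixed element `f` of $2V$ and one
fixed rectangle; only the starting point varies with the program.

A point of $C^2$ is read as a state together with two stacks, and a finite list of prefix
replacements as a machine acting on it. If the domains are disjoint and the ranges are disjoint, the
list is a partial injection. `exists_mem_twoV_simulating` extends it to $2V$ by doubling the space: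
one involution $\sigma$ exchanges the domain of each rule, tagged `true`, with its range, tagged
`false`; another, $\tau$, flips the tag. Then $\tau\sigma$ runs forward on one copy, backward on the
other, and changes direction where no rule applies. If the starting point has no predecessor, even
its full orbit sees only configurations reachable from it.

An irreversible one-register machine is made injective by pushing the past on the second stack. The
register is a unary number on the first stack; division with remainder moves the quotient to the
second stack, and multiplication moves it back (`Represents.exists_transGen`). A rectangle can test
for the halting state, whence `exists_mem_twoV_halting`.

Such machines are universal by Gödel numbering: the exponents of the primes in the one register are
the contents of many counters. Counter programs compute every primitive recursive function
(`Prog.computable_of_primrec'`), and one more loop searches for a zero (`Prog.exists_search`).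
Searching for a time bound within which a program halts gives the reduction. The forward orbit meets
the rectangle if the program halts, and the full orbit only if it does, so both questions are
settled at once. -/

/-! ### Prefixes, dyadic intervals and continuity -/

theorem cat_injective (α : Word) : Function.Injective (cat α) := by
  induction α with
  | nil => exact fun _ _ h => h
  | cons b α ih => exact fun ψ ω h => ih (cons_inj h).2

/-- Put a pair of words in front of a point of `C²`. -/
def catPair (w : Word × Word) (x : Cantor × Cantor) : Cantor × Cantor := (cat w.1 x.1, cat w.2 x.2)

theorem catPair_injective (w : Word × Word) : Function.Injective (catPair w) := by
  intro x y h
  obtain ⟨h1, h2⟩ := Prod.mk.inj h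
  exact Prod.ext (cat_injective _ h1) (cat_injective _ h2)

theorem mem_rect_iff {w : Word × Word} {p : Cantor × Cantor} :
    p ∈ rect w.1 w.2 ↔ ∃ x, p = catPair w x := by
  constructor
  · rintro ⟨⟨ψ, h1⟩, ⟨ω, h2⟩⟩
    exact ⟨(ψ, ω), Prod.ext h1 h2⟩
  · rintro ⟨x, rfl⟩
    exact mem_rect

theorem cat_add_length (α : Word) (ψ : Cantor) (n : ℕ) : cat α ψ (n + α.length) = ψ n := by
  induction α with
  | nil => rfl
  | cons b α ih => exact ih

theorem continuous_cat (α : Word) : Continuous (cat α) := by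
  induction α with
  | nil => exact continuous_id
  | cons b α ih =>
    refine continuous_pi fun n => ?_
    cases n with
    | zero => exact continuous_const
    | succ n => exact (continuous_apply n).comp ih

theorem isOpen_interval (α : Word) : IsOpen (interval α) := by
  induction α with
  | nil =>
    convert isOpen_univ
    exact Set.eq_univ_of_forall fun x => ⟨x, rfl⟩
  | cons b α ih =>
    have : interval (b :: α) =
        (fun x : Cantor => x 0) ⁻¹' {b} ∩ (fun (x : Cantor) n => x (n + 1)) ⁻¹' interval α := by
      ext x
      constructor
      · rintro ⟨ψ, rfl⟩
        exact ⟨rfl, ψ, rfl⟩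
      · rintro ⟨h, ψ, hψ⟩
        refine ⟨ψ, funext fun n => ?_⟩
        cases n with
        | zero => exact h
        | succ n => exact congrFun hψ n
    rw [this]
    exact ((isOpen_discrete _).preimage (continuous_apply 0)).inter
      (ih.preimage (continuous_pi fun n => continuous_apply (n + 1)))

/-- `f` is a prefix replacement on every product of intervals of depth `N`, for some `N`. -/
def IsPiecewisePrefixReplacement (f : Cantor × Cantor → Cantor × Cantor) : Prop :=
  ∃ N : ℕ, ∀ u v : Word, u.length = N → v.length = N → ∃ γ δ, IsPrefixReplacement f u v γ δ

theorem IsPiecewisePrefixReplacement.continuous {f : Cantor × Cantor → Cantor × Cantor}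
    (hf : IsPiecewisePrefixReplacement f) : Continuous f := by
  obtain ⟨N, hN⟩ := hf
  refine continuous_iff_continuousAt.2 ?_
  rintro ⟨x, y⟩
  obtain ⟨u, hu, ψ, rfl⟩ := exists_cat_eq N x
  obtain ⟨v, hv, ω, rfl⟩ := exists_cat_eq N y
  obtain ⟨γ, δ, h⟩ := hN u v hu hv
  -- Deleting and prepending fixed numbers of digits is continuous on all of $C^2$ and agrees with
  -- `f` on the open rectangle `rect u v`.
  have hc : Continuous fun q : Cantor × Cantor =>
      (cat γ fun n => q.1 (n + u.length), cat δ fun n => q.2 (n + v.length)) :=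
    ((continuous_cat γ).comp (continuous_pi fun n =>
      (continuous_apply (n + u.length)).comp continuous_fst)).prodMk
    ((continuous_cat δ).comp (continuous_pi fun n =>
      (continuous_apply (n + v.length)).comp continuous_snd))
  refine hc.continuousAt.congr ?_
  filter_upwards [((isOpen_interval u).prod (isOpen_interval v)).mem_nhds mem_rect]
  rintro ⟨_, _⟩ ⟨⟨ψ', rfl⟩, ⟨ω', rfl⟩⟩
  rw [h]
  simp only [cat_add_length]

/-! ### Elements of $2V$ from finite sets of exchange rules -/

/-- A prefix replacement rule: the rectangle of the first pair of words is mapped to the rectangle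
of the second one. -/
abbrev Rule : Type := (Word × Word) × (Word × Word)

/-- The rectangles of the first components of the rules are disjoint. -/
def DisjointDomains (E : Set Rule) : Prop :=
  ∀ e ∈ E, ∀ e' ∈ E, ∀ x x', catPair e.1 x = catPair e'.1 x' → e = e'

open Classical in
/-- The map that applies the rules of `E` and fixes the points to which no rule applies. -/
noncomputable def exchange (E : Set Rule) (p : Cantor × Cantor) : Cantor × Cantor :=
  if h : ∃ e ∈ E, ∃ x, p = catPair e.1 x then catPair h.choose.2 h.choose_spec.2.choose else p

theorem exchange_catPair {E : Set Rule} (hE : DisjointDomains E) {e : Rule} (he : e ∈ E)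
    (x : Cantor × Cantor) : exchange E (catPair e.1 x) = catPair e.2 x := by
  have h : ∃ e' ∈ E, ∃ x', catPair e.1 x = catPair e'.1 x' := ⟨e, he, x, rfl⟩
  rw [exchange, dif_pos h]
  have h1 := h.choose_spec.1
  have h2 := h.choose_spec.2.choose_spec
  have h3 := hE _ he _ h1 _ _ h2
  generalize h.choose_spec.2.choose = x' at *
  generalize h.choose = e' at *
  subst h3
  rw [catPair_injective _ h2]

theorem exchange_of_not {E : Set Rule} {p : Cantor × Cantor}
    (h : ¬∃ e ∈ E, ∃ x, p = catPair e.1 x) : exchange E p = p := dif_neg h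

theorem exchange_involutive {E : Set Rule} (hE : DisjointDomains E) (hs : ∀ e ∈ E, e.swap ∈ E) :
    Function.Involutive (exchange E) := by
  intro p
  by_cases h : ∃ e ∈ E, ∃ x, p = catPair e.1 x
  · obtain ⟨e, he, x, rfl⟩ := h
    rw [exchange_catPair hE he]
    exact exchange_catPair hE (hs e he) x
  · rw [exchange_of_not h, exchange_of_not h]

/-- At a depth exceeding the length of every prefix in the rules, a dyadic rectangle either lies
inside the domain of one rule or meets none of the domains. -/
theorem exchange_isPiecewisePrefixReplacement {E : Set Rule} (hE : DisjointDomains E)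
    (hfin : E.Finite) : IsPiecewisePrefixReplacement (exchange E) := by
  obtain ⟨N, hN⟩ := (hfin.image fun e : Rule => max e.1.1.length e.1.2.length).bddAbove
  refine ⟨N, fun u v hu hv => ?_⟩
  by_cases h : ∃ e ∈ E, ∃ s t, u = e.1.1 ++ s ∧ v = e.1.2 ++ t
  · obtain ⟨e, he, s, t, rfl, rfl⟩ := h
    refine ⟨e.2.1 ++ s, e.2.2 ++ t, fun ψ ω => ?_⟩
    simp only [cat_append]
    exact exchange_catPair hE he (cat s ψ, cat t ω)
  · refine ⟨u, v, fun ψ ω => exchange_of_not ?_⟩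
    rintro ⟨e, he, x, hx⟩
    have hle : max e.1.1.length e.1.2.length ≤ N := hN ⟨e, he, rfl⟩
    obtain ⟨h1, h2⟩ := Prod.mk.inj hx
    obtain ⟨s, hs, -⟩ := exists_append_of_cat_eq e.1.1 u _ _ (by omega) h1
    obtain ⟨t, ht, -⟩ := exists_append_of_cat_eq e.1.2 v _ _ (by omega) h2
    exact h ⟨e, he, s, t, hs, ht⟩

theorem exists_mem_twoV_eq_exchange {E : Set Rule} (hE : DisjointDomains E)
    (hs : ∀ e ∈ E, e.swap ∈ E) (hfin : E.Finite) : ∃ f ∈ TwoV, ∀ p, f p = exchange E p := by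
  have hp := exchange_isPiecewisePrefixReplacement hE hfin
  exact ⟨⟨(exchange_involutive hE hs).toPerm, hp.continuous, hp.continuous⟩,
    (isTwoV_iff _).2 hp, fun p => rfl⟩

/-- Every element of `2V` has a numbered pattern pair. -/
theorem exists_isPatternPairFor {f : (Cantor × Cantor) ≃ₜ (Cantor × Cantor)} (hf : f ∈ TwoV) :
    ∃ P, IsPatternPairFor P f := by
  obtain ⟨N, hN⟩ := (isTwoV_iff f).1 hf
  choose! γ δ h using hN
  have hfin := (List.finite_length_eq Bool N).prod (List.finite_length_eq Bool N)
  set W : List (Word × Word) := hfin.toFinset.toList with hW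
  have hmem : ∀ w : Word × Word, w ∈ W ↔ w.1.length = N ∧ w.2.length = N := by simp [hW]
  have hinj : ∀ w ∈ W, ∀ w' ∈ W, ∀ p, p ∈ rect w.1 w.2 → p ∈ rect w'.1 w'.2 → w = w' := by
    rintro ⟨u, v⟩ hw ⟨u', v'⟩ hw' p ⟨⟨a, ha⟩, ⟨b, hb⟩⟩ ⟨⟨a', ha'⟩, ⟨b', hb'⟩⟩
    obtain ⟨h1, h2⟩ := (hmem _).1 hw
    obtain ⟨h1', h2'⟩ := (hmem _).1 hw'
    exact Prod.ext (eq_of_cat_eq (h1.trans h1'.symm) (ha.symm.trans ha'))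
      (eq_of_cat_eq (h2.trans h2'.symm) (hb.symm.trans hb'))
  have hcov : ∀ p, ∃ w ∈ W, p ∈ rect w.1 w.2 := by
    rintro ⟨x, y⟩
    obtain ⟨u, hu, ψ, rfl⟩ := exists_cat_eq N x
    obtain ⟨v, hv, ω, rfl⟩ := exists_cat_eq N y
    exact ⟨(u, v), (hmem _).2 ⟨hu, hv⟩, mem_rect⟩
  have key : ∀ g : Word × Word → Word × Word,
      (∀ w ∈ W, ∀ w' ∈ W, ∀ p, p ∈ rect (g w).1 (g w).2 → p ∈ rect (g w').1 (g w').2 → w = w') →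
      (∀ p, ∃ w ∈ W, p ∈ rect (g w).1 (g w).2) → IsNumberedPattern (W.map g) := by
    intro g hg1 hg2
    refine ⟨?_, ?_, ?_, ?_, ?_⟩
    · rw [List.map_map]
      refine (Finset.nodup_toList _).map_on fun w hw w' hw' he => hg1 w hw w' hw'
        (catPair (g w) (fun _ => false, fun _ => false)) mem_rect ?_
      have he' : rect (g w).1 (g w).2 = rect (g w').1 (g w').2 := he
      rw [← he']
      exact mem_rect
    · exact List.finite_toSet _
    · rintro R hR
      obtain ⟨w, -, rfl⟩ := List.mem_map.1 hR
      exact ⟨_, _, rfl⟩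
    · rintro hR
      obtain ⟨w, -, hw⟩ := List.mem_map.1 hR
      have : catPair w (fun _ => false, fun _ => false) ∈ rect w.1 w.2 := mem_rect
      rw [hw] at this
      exact this
    · intro p
      obtain ⟨w, hw, hp⟩ := hg2 p
      refine ⟨_, ⟨List.mem_map.2 ⟨_, List.mem_map.2 ⟨w, hw, rfl⟩, rfl⟩, hp⟩, ?_⟩
      rintro R ⟨hR, hpR⟩
      obtain ⟨v, hv, rfl⟩ := List.mem_map.1 hR
      obtain ⟨w', hw', rfl⟩ := List.mem_map.1 hv
      rw [hg1 w hw w' hw' p hp hpR]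
  -- The range rectangles are the `f`-images of the domain rectangles, so they inherit disjointness
  -- and covering.
  have him : ∀ w ∈ W, ∀ p, p ∈ rect (γ w.1 w.2) (δ w.1 w.2) ↔ f.symm p ∈ rect w.1 w.2 := by
    intro w hw p
    obtain ⟨h1, h2⟩ := (hmem _).1 hw
    rw [← image_rect (h w.1 w.2 h1 h2)]
    constructor
    · rintro ⟨q, hq, rfl⟩
      simpa using hq
    · exact fun hq => ⟨_, hq, by simp⟩
  refine ⟨W.map fun w => (w, (γ w.1 w.2, δ w.1 w.2)), ?_, ?_, ?_⟩
  · rw [List.map_map]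
    exact key _ hinj hcov
  · rw [List.map_map]
    refine key _ (fun w hw w' hw' p hp hp' => hinj w hw w' hw' (f.symm p)
      ((him w hw p).1 hp) ((him w' hw' p).1 hp')) fun p => ?_
    obtain ⟨w, hw, hp⟩ := hcov (f.symm p)
    exact ⟨w, hw, (him w hw p).2 hp⟩
  · intro e he
    obtain ⟨w, hw, rfl⟩ := List.mem_map.1 he
    obtain ⟨h1, h2⟩ := (hmem _).1 hw
    exact h w.1 w.2 h1 h2

/-! ### Simulating a partial injection inside $2V$ -/

/-- One step of the partial map given by the rules of `E`. -/
def Step (E : Set Rule) (p q : Cantor × Cantor) : Prop :=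
  ∃ e ∈ E, ∃ x, p = catPair e.1 x ∧ q = catPair e.2 x

/-- Put a digit in front of the first coordinate. -/
def tag (b : Bool) (p : Cantor × Cantor) : Cantor × Cantor := (cons b p.1, p.2)

theorem tag_inj {b c : Bool} {p q : Cantor × Cantor} (h : tag b p = tag c q) : b = c ∧ p = q := by
  obtain ⟨h1, h2⟩ := Prod.mk.inj h
  obtain ⟨h3, h4⟩ := cons_inj h1
  exact ⟨h3, Prod.ext h4 h2⟩

/-- A partial injection given by prefix replacement rules is simulated by an element of `2V` that
runs it forward on the points tagged `true` and backward on those tagged `false`. -/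
theorem exists_mem_twoV_simulating {E : Set Rule} (hfin : E.Finite) (hdom : DisjointDomains E)
    (hran : DisjointDomains (Prod.swap '' E)) :
    ∃ f ∈ TwoV, (∀ p q, Step E p q → f (tag true p) = tag true q) ∧
      ∀ p₀, (¬∃ p, Step E p p₀) → ∀ q ∈ fullOrbit f (tag true p₀),
        ∃ b p, q = tag b p ∧ Relation.ReflTransGen (Step E) p₀ p := by
  set up : Rule → Rule := fun e => ((true :: e.1.1, e.1.2), (false :: e.2.1, e.2.2)) with hup
  set F : Set Rule := up '' E ∪ Prod.swap '' (up '' E) with hF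
  have hcat1 : ∀ e x, catPair (up e).1 x = tag true (catPair e.1 x) := fun _ _ => rfl
  have hcat2 : ∀ e x, catPair (up e).2 x = tag false (catPair e.2 x) := fun _ _ => rfl
  have hFd : DisjointDomains F := by
    rintro _ (⟨e, he, rfl⟩ | ⟨_, ⟨e, he, rfl⟩, rfl⟩) _ (⟨e', he', rfl⟩ | ⟨_, ⟨e', he', rfl⟩, rfl⟩)
      x x' h
    · have h' : tag true (catPair e.1 x) = tag true (catPair e'.1 x') := h
      rw [hdom e he e' he' x x' (tag_inj h').2]
    · have h' : tag true (catPair e.1 x) = tag false (catPair e'.2 x') := h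
      exact absurd (tag_inj h').1 (by simp)
    · have h' : tag false (catPair e.2 x) = tag true (catPair e'.1 x') := h
      exact absurd (tag_inj h').1 (by simp)
    · have h' : tag false (catPair e.2 x) = tag false (catPair e'.2 x') := h
      rw [Prod.swap_injective
        (hran e.swap ⟨e, he, rfl⟩ e'.swap ⟨e', he', rfl⟩ x x' (tag_inj h').2)]
  have hFs : ∀ e ∈ F, e.swap ∈ F := by
    rintro _ (⟨e, he, rfl⟩ | ⟨_, ⟨e, he, rfl⟩, rfl⟩)
    · exact Or.inr ⟨_, ⟨e, he, rfl⟩, rfl⟩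
    · exact Or.inl ⟨e, he, rfl⟩
  obtain ⟨σ, hσ, hσF⟩ := exists_mem_twoV_eq_exchange hFd hFs
    ((hfin.image _).union ((hfin.image _).image _))
  set G : Set Rule := {(([true], []), ([false], [])), (([false], []), ([true], []))} with hG
  have hGd : DisjointDomains G := by
    rintro _ (rfl | rfl) _ (rfl | rfl) x x' h
    · rfl
    · have h' : tag true x = tag false x' := h
      exact absurd (tag_inj h').1 (by simp)
    · have h' : tag false x = tag true x' := h
      exact absurd (tag_inj h').1 (by simp)
    · rfl
  have hGs : ∀ e ∈ G, e.swap ∈ G := by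
    rintro _ (rfl | rfl)
    · exact Or.inr rfl
    · exact Or.inl rfl
  obtain ⟨τ, hτ, hτG⟩ := exists_mem_twoV_eq_exchange hGd hGs (Set.toFinite _)
  have hτt : ∀ b p, τ (tag b p) = tag (!b) p := by
    rintro (_ | _) p
    · rw [hτG]
      exact exchange_catPair hGd (Or.inr rfl) p
    · rw [hτG]
      exact exchange_catPair hGd (Or.inl rfl) p
  have hστ : ∀ p, σ (σ p) = p := fun p => by
    rw [hσF, hσF, exchange_involutive hFd hFs]
  have hσt : ∀ p q, Step E p q → σ (tag true p) = tag false q := by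
    rintro _ _ ⟨e, he, x, rfl, rfl⟩
    rw [hσF, ← hcat1, ← hcat2]
    exact exchange_catPair hFd (Or.inl ⟨e, he, rfl⟩) x
  have hσf : ∀ p q, Step E p q → σ (tag false q) = tag true p := by
    intro p q h
    rw [← hσt p q h, hστ]
  refine ⟨τ * σ, TwoV.mul_mem hτ hσ, fun p q h => ?_, fun p₀ h₀ => ?_⟩
  · change τ (σ _) = _
    rw [hσt p q h, hτt, Bool.not_false]
  · set S : Set (Cantor × Cantor) :=
      {q | ∃ b p, q = tag b p ∧ Relation.ReflTransGen (Step E) p₀ p} with hS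
    have hτS : ∀ q ∈ S, τ q ∈ S := by
      rintro _ ⟨b, p, rfl, h⟩
      exact ⟨_, p, hτt b p, h⟩
    have hσS : ∀ q ∈ S, σ q ∈ S := by
      rintro _ ⟨b, p, rfl, h⟩
      by_cases hb : ∃ e ∈ F, ∃ x, tag b p = catPair e.1 x
      · obtain ⟨_, ⟨e, he, rfl⟩ | ⟨_, ⟨e, he, rfl⟩, rfl⟩, x, hx⟩ := hb
        · obtain ⟨rfl, rfl⟩ := tag_inj (hx.trans (hcat1 e x))
          have hst : Step E (catPair e.1 x) (catPair e.2 x) := ⟨e, he, x, rfl, rfl⟩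
          exact ⟨_, _, hσt _ _ hst, h.tail hst⟩
        · obtain ⟨rfl, rfl⟩ := tag_inj (hx.trans (hcat2 e x))
          -- Here $\sigma$ undoes a step. The point is not `p₀`, which has no predecessor, so the
          -- last step of the path leading to it supplies a reachable predecessor.
          rcases Relation.ReflTransGen.cases_tail h with h | ⟨p', h', hst⟩
          · exact absurd ⟨_, e, he, x, rfl, h.symm⟩ h₀
          · exact ⟨_, _, hσf _ _ hst, h'⟩
      · exact ⟨b, p, by rw [hσF, exchange_of_not hb], h⟩
    have hinv : ∀ q ∈ S, (τ * σ)⁻¹ q ∈ S := by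
      intro q hq
      -- Both factors are involutions, so the inverse of $\tau\sigma$ is $\sigma\tau$, which
      -- preserves `S` as well.
      have h1 : (τ * σ) (σ (τ q)) = q := by
        change τ (σ (σ (τ q))) = q
        rw [hστ, hτG, hτG, exchange_involutive hGd hGs]
      have h2 : (τ * σ)⁻¹ q = σ (τ q) := by
        rw [← h1]
        change (τ * σ).symm ((τ * σ) _) = _
        rw [Homeomorph.symm_apply_apply, h1]
      rw [h2]
      exact hσS _ (hτS _ hq)
    have hpow : ∀ g : (Cantor × Cantor) ≃ₜ (Cantor × Cantor), (∀ q ∈ S, g q ∈ S) →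
        ∀ n : ℕ, ∀ q ∈ S, (g ^ n) q ∈ S := by
      intro g hg n
      induction n with
      | zero => exact fun q hq => hq
      | succ n ih =>
        intro q hq
        rw [pow_succ]
        exact ih _ (hg q hq)
    have hp₀ : tag true p₀ ∈ S := ⟨true, p₀, rfl, .refl⟩
    rintro _ ⟨n, rfl⟩
    obtain ⟨n, rfl | rfl⟩ := n.eq_nat_or_neg
    · rw [zpow_natCast]
      exact hpow (τ * σ) (fun q hq => hτS (σ q) (hσS q hq)) n _ hp₀
    · rw [zpow_neg, zpow_natCast, ← inv_pow]
      exact hpow _ hinv n _ hp₀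

/-! ### Unary numbers -/

/-- The sequence `1ⁿψ`. -/
def ones (n : ℕ) (ψ : Cantor) : Cantor := cat (List.replicate n true) ψ

theorem ones_add (m n : ℕ) (ψ : Cantor) : ones (m + n) ψ = ones m (ones n ψ) := by
  rw [ones, List.replicate_add, cat_append]
  rfl

theorem ones_cons_true (n : ℕ) (ψ : Cantor) : ones n (cons true ψ) = ones (n + 1) ψ :=
  (ones_add n 1 ψ).symm

theorem ones_inj {m n : ℕ} {ψ ω : Cantor} (h : ones m (cons false ψ) = ones n (cons false ω)) :
    m = n ∧ ψ = ω := by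
  induction m generalizing n with
  | zero =>
    cases n with
    | zero => exact ⟨rfl, (cons_inj h).2⟩
    | succ n => exact absurd (cons_inj h).1 (by simp)
  | succ m ih =>
    cases n with
    | zero => exact absurd (cons_inj h).1 (by simp)
    | succ n =>
      obtain ⟨rfl, rfl⟩ := ih (cons_inj h).2
      exact ⟨rfl, rfl⟩

theorem le_of_ones_eq {m n : ℕ} {ψ ω : Cantor} (h : ones m ψ = ones n (cons false ω)) : m ≤ n := by
  induction m generalizing n with
  | zero => exact n.zero_le
  | succ m ih =>
    cases n with
    | zero => exact absurd (cons_inj h).1 (by simp)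
    | succ n => exact Nat.succ_le_succ (ih (cons_inj h).2)

/-- The constant sequence `000…`. -/
def zeros : Cantor := fun _ => false

theorem cons_false_zeros : cons false zeros = zeros := by
  funext n
  cases n <;> rfl

/-! ### One-register machines as reversible prefix replacements -/

/-- An instruction of a machine with one register: a register content `m * k + r` with `r < m` is
replaced by `mul r * k + add r`, and the state by `next r`. -/
structure Instr (S : Type) where
  mod : ℕ
  mul : ℕ → ℕ
  add : ℕ → ℕ
  next : ℕ → S
  mod_pos : 0 < mod
  mul_pos : ∀ r, 0 < mul r

section Machine

variable {S : Type} [Encodable S]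

/-- The prefix code `1ⁿ⁺¹0` of the objects of a countable type. -/
def code {A : Type} [Encodable A] (a : A) : Word :=
  List.replicate (Encodable.encode a + 1) true ++ [false]

theorem cat_code {A : Type} [Encodable A] (a : A) (ψ : Cantor) :
    cat (code a) ψ = ones (Encodable.encode a + 1) (cons false ψ) := by
  rw [code, cat_append]
  rfl

theorem code_inj {A : Type} [Encodable A] {a b : A} {ψ ω : Cantor}
    (h : cat (code a) ψ = cat (code b) ω) : a = b ∧ ψ = ω := by
  rw [cat_code, cat_code] at h
  obtain ⟨h1, h2⟩ := ones_inj h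
  exact ⟨Encodable.encode_injective (Nat.succ_injective h1), h2⟩

/-- The point of `C²` with state `k` and contents `x` and `y` of the two stacks. -/
def point (k : S × Option ℕ) (x y : Cantor) : Cantor × Cantor := (cat (code k) x, y)

theorem point_inj {k k' : S × Option ℕ} {x x' y y' : Cantor} (h : point k x y = point k' x' y') :
    k = k' ∧ x = x' ∧ y = y' := by
  obtain ⟨h1, h2⟩ := Prod.mk.inj h
  exact ⟨(code_inj h1).1, (code_inj h1).2, h2⟩

/-- Divide the unary number on the first stack, counting on the second. -/
def carryRule (q : S) (m : ℕ) : Rule :=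
  ((code (q, (none : Option ℕ)) ++ List.replicate m true, []),
    (code (q, (none : Option ℕ)), [true]))

/-- Remember the remainder. -/
def exitRule (q : S) (r : ℕ) : Rule :=
  ((code (q, (none : Option ℕ)) ++ (List.replicate r true ++ [false]), []),
    -- The 0 is kept on the first stack so that this range is disjoint from those of the expand
    -- rules, which show a 1 there.
    (code (q, some r) ++ [false], []))

/-- Multiply the unary number on the second stack. -/
def expandRule (q : S) (r m : ℕ) : Rule :=
  ((code (q, some r), [true]), (code (q, some r) ++ List.replicate m true, []))

/-- Go to the next state, and record the past on the second stack. -/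
def finishRule (q : S) (r a : ℕ) (q' : S) : Rule :=
  ((code (q, some r), [false]),
    -- The 0 on top will end the unary quotient counted above it, and separates this range from
    -- those of the carry rules.
    (code (q', (none : Option ℕ)) ++ List.replicate a true, false :: code (q, some r)))

theorem carryRule_fst (q : S) (m : ℕ) (x : Cantor × Cantor) :
    catPair (carryRule q m).1 x = point (q, none) (ones m x.1) x.2 :=
  Prod.ext (cat_append _ _ _) rfl

theorem carryRule_snd (q : S) (m : ℕ) (x : Cantor × Cantor) :
    catPair (carryRule q m).2 x = point (q, none) x.1 (cons true x.2) := rfl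

theorem exitRule_fst (q : S) (r : ℕ) (x : Cantor × Cantor) :
    catPair (exitRule q r).1 x = point (q, none) (ones r (cons false x.1)) x.2 :=
  Prod.ext ((cat_append _ _ _).trans (congrArg _ (cat_append _ _ _))) rfl

theorem exitRule_snd (q : S) (r : ℕ) (x : Cantor × Cantor) :
    catPair (exitRule q r).2 x = point (q, some r) (cons false x.1) x.2 :=
  Prod.ext (cat_append _ _ _) rfl

theorem expandRule_snd (q : S) (r m : ℕ) (x : Cantor × Cantor) :
    catPair (expandRule q r m).2 x = point (q, some r) (ones m x.1) x.2 :=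
  Prod.ext (cat_append _ _ _) rfl

theorem finishRule_snd (q : S) (r a : ℕ) (q' : S) (x : Cantor × Cantor) :
    catPair (finishRule q r a q').2 x =
      point (q', none) (ones a x.1) (cons false (cat (code (q, some r)) x.2)) :=
  Prod.ext (cat_append _ _ _) rfl

/-- The prefix replacement rules of the machine `M`, restricted to the states in `T`. -/
inductive IsRule (M : S → Option (Instr S)) (T : Finset S) : Rule → Prop
  | carry {q i} : q ∈ T → M q = some i → IsRule M T (carryRule q i.mod)
  | exit {q i r} : q ∈ T → M q = some i → r < i.mod → IsRule M T (exitRule q r)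
  | expand {q i r} : q ∈ T → M q = some i → r < i.mod → IsRule M T (expandRule q r (i.mul r))
  | finish {q i r} : q ∈ T → M q = some i → r < i.mod →
      IsRule M T (finishRule q r (i.add r) (i.next r))

variable {M : S → Option (Instr S)} {T : Finset S}

theorem finite_setOf_isRule : {e | IsRule M T e}.Finite := by
  have hfin : (⋃ q ∈ T, ⋃ i ∈ {i | M q = some i}, ({carryRule q i.mod} ∪
      ((exitRule q '' Set.Iio i.mod) ∪ (((fun r => expandRule q r (i.mul r)) '' Set.Iio i.mod) ∪
        ((fun r => finishRule q r (i.add r) (i.next r)) '' Set.Iio i.mod))))).Finite := by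
    refine T.finite_toSet.biUnion fun q _ => Set.Finite.biUnion ?_ fun i _ => ?_
    · exact Set.Subsingleton.finite fun i hi j hj => Option.some.inj (hi.symm.trans hj)
    · exact (Set.finite_singleton _).union (((Set.finite_Iio _).image _).union
        (((Set.finite_Iio _).image _).union ((Set.finite_Iio _).image _)))
  refine hfin.subset fun e he => ?_
  simp only [Set.mem_iUnion]
  cases he with
  | carry hq hi => exact ⟨_, hq, _, hi, Or.inl rfl⟩
  | exit hq hi hr => exact ⟨_, hq, _, hi, Or.inr (Or.inl ⟨_, hr, rfl⟩)⟩
  | expand hq hi hr => exact ⟨_, hq, _, hi, Or.inr (Or.inr (Or.inl ⟨_, hr, rfl⟩))⟩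
  | finish hq hi hr => exact ⟨_, hq, _, hi, Or.inr (Or.inr (Or.inr ⟨_, hr, rfl⟩))⟩

/-- Determinism. In a state `(q, none)`, carrying needs at least `i.mod` leading 1s and exiting
exactly `r < i.mod` of them before a 0; in a state `(q, some r)`, the top digit of the second stack
decides. -/
theorem disjointDomains_setOf_isRule : DisjointDomains {e | IsRule M T e} := by
  intro e he e' he' x x' h
  cases he with
  | @carry q i hq hi =>
    cases he' with
    | @carry q' i' hq' hi' =>
      obtain ⟨hk, -⟩ := point_inj ((carryRule_fst _ _ _).symm.trans (h.trans (carryRule_fst _ _ _)))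
      obtain rfl := congrArg Prod.fst hk
      rw [Option.some.inj (hi.symm.trans hi')]
    | @exit q' i' r' hq' hi' hr' =>
      obtain ⟨hk, hx, -⟩ :=
        point_inj ((carryRule_fst _ _ _).symm.trans (h.trans (exitRule_fst _ _ _)))
      obtain rfl := congrArg Prod.fst hk
      obtain rfl := Option.some.inj (hi.symm.trans hi')
      exact absurd (le_of_ones_eq hx) (by omega)
    | expand =>
      exact absurd (congrArg Prod.snd (point_inj ((carryRule_fst _ _ _).symm.trans h)).1) (by simp)
    | finish =>
      exact absurd (congrArg Prod.snd (point_inj ((carryRule_fst _ _ _).symm.trans h)).1) (by simp)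
  | @exit q i r hq hi hr =>
    cases he' with
    | @carry q' i' hq' hi' =>
      obtain ⟨hk, hx, -⟩ :=
        point_inj ((exitRule_fst _ _ _).symm.trans (h.trans (carryRule_fst _ _ _)))
      obtain rfl := congrArg Prod.fst hk
      obtain rfl := Option.some.inj (hi.symm.trans hi')
      exact absurd (le_of_ones_eq hx.symm) (by omega)
    | @exit q' i' r' hq' hi' hr' =>
      obtain ⟨hk, hx, -⟩ :=
        point_inj ((exitRule_fst _ _ _).symm.trans (h.trans (exitRule_fst _ _ _)))
      obtain rfl := congrArg Prod.fst hk
      rw [(ones_inj hx).1]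
    | expand =>
      exact absurd (congrArg Prod.snd (point_inj ((exitRule_fst _ _ _).symm.trans h)).1) (by simp)
    | finish =>
      exact absurd (congrArg Prod.snd (point_inj ((exitRule_fst _ _ _).symm.trans h)).1) (by simp)
  | @expand q i r hq hi hr =>
    cases he' with
    | carry =>
      exact absurd (congrArg Prod.snd (point_inj (h.trans (carryRule_fst _ _ _))).1) (by simp)
    | exit =>
      exact absurd (congrArg Prod.snd (point_inj (h.trans (exitRule_fst _ _ _))).1) (by simp)
    | @expand q' i' r' hq' hi' hr' =>
      obtain ⟨hk, -⟩ := point_inj h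
      obtain ⟨rfl, hr⟩ := Prod.mk.inj hk
      rw [Option.some.inj hr, Option.some.inj (hi.symm.trans hi')]
    | finish => exact absurd (cons_inj (point_inj h).2.2).1 (by simp)
  | @finish q i r hq hi hr =>
    cases he' with
    | carry =>
      exact absurd (congrArg Prod.snd (point_inj (h.trans (carryRule_fst _ _ _))).1) (by simp)
    | exit =>
      exact absurd (congrArg Prod.snd (point_inj (h.trans (exitRule_fst _ _ _))).1) (by simp)
    | expand => exact absurd (cons_inj (point_inj h).2.2).1 (by simp)
    | @finish q' i' r' hq' hi' hr' =>
      obtain ⟨hk, -⟩ := point_inj h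
      obtain ⟨rfl, hr⟩ := Prod.mk.inj hk
      rw [Option.some.inj hr, Option.some.inj (hi.symm.trans hi')]

theorem ones_ne_cons_false {n : ℕ} (hn : 0 < n) (ψ ω : Cantor) : ones n ψ ≠ cons false ω := by
  obtain ⟨n, rfl⟩ := Nat.exists_eq_succ_of_ne_zero hn.ne'
  exact fun h => absurd (cons_inj h).1 (by simp)

/-- Reversibility. For a state `(q, none)` the second stack starts with 1 after a carry and with 0
after a finish, and in the latter case the recorded code identifies the rule. For `(q, some r)` the
first stack starts with 0 after an exit and with 1 after an expansion, since the multipliers are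
positive. -/
theorem disjointDomains_swap_setOf_isRule : DisjointDomains (Prod.swap '' {e | IsRule M T e}) := by
  rintro _ ⟨e, he, rfl⟩ _ ⟨e', he', rfl⟩ x x' h
  simp only [Prod.fst_swap] at h
  congr 1
  cases he with
  | @carry q i hq hi =>
    cases he' with
    | @carry q' i' hq' hi' =>
      obtain rfl := congrArg Prod.fst (point_inj h).1
      rw [Option.some.inj (hi.symm.trans hi')]
    | exit =>
      exact absurd (congrArg Prod.snd (point_inj (h.trans (exitRule_snd _ _ _))).1) (by simp)
    | expand =>
      exact absurd (congrArg Prod.snd (point_inj (h.trans (expandRule_snd _ _ _ _))).1) (by simp)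
    | finish =>
      exact absurd (cons_inj (point_inj (h.trans (finishRule_snd _ _ _ _ _))).2.2).1 (by simp)
  | @exit q i r hq hi hr =>
    rw [exitRule_snd] at h
    cases he' with
    | carry => exact absurd (congrArg Prod.snd (point_inj h).1) (by simp)
    | @exit q' i' r' hq' hi' hr' =>
      rw [exitRule_snd] at h
      obtain ⟨rfl, hr⟩ := Prod.mk.inj (point_inj h).1
      rw [Option.some.inj hr]
    | @expand q' i' r' hq' hi' hr' =>
      rw [expandRule_snd] at h
      exact absurd (point_inj h).2.1.symm (ones_ne_cons_false (i'.mul_pos r') _ _)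
    | finish =>
      exact absurd (congrArg Prod.snd (point_inj (h.trans (finishRule_snd _ _ _ _ _))).1) (by simp)
  | @expand q i r hq hi hr =>
    rw [expandRule_snd] at h
    cases he' with
    | carry => exact absurd (congrArg Prod.snd (point_inj h).1) (by simp)
    | exit =>
      rw [exitRule_snd] at h
      exact absurd (point_inj h).2.1 (ones_ne_cons_false (i.mul_pos r) _ _)
    | @expand q' i' r' hq' hi' hr' =>
      rw [expandRule_snd] at h
      obtain ⟨rfl, hr⟩ := Prod.mk.inj (point_inj h).1
      rw [Option.some.inj hr, Option.some.inj (hi.symm.trans hi')]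
    | finish =>
      exact absurd (congrArg Prod.snd (point_inj (h.trans (finishRule_snd _ _ _ _ _))).1) (by simp)
  | @finish q i r hq hi hr =>
    rw [finishRule_snd] at h
    cases he' with
    | carry => exact absurd (cons_inj (point_inj h).2.2).1 (by simp)
    | exit =>
      exact absurd (congrArg Prod.snd (point_inj (h.trans (exitRule_snd _ _ _))).1) (by simp)
    | expand =>
      exact absurd (congrArg Prod.snd (point_inj (h.trans (expandRule_snd _ _ _ _))).1) (by simp)
    | @finish q' i' r' hq' hi' hr' =>
      rw [finishRule_snd] at h
      obtain ⟨rfl, hr⟩ := Prod.mk.inj (code_inj (cons_inj (point_inj h).2.2).2).1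
      rw [Option.some.inj hr, Option.some.inj (hi.symm.trans hi')]

/-! ### Correctness of the simulation -/

/-- One step of the machine `M`, restricted to the states in `T`. -/
def MachineStep (M : S → Option (Instr S)) (T : Finset S) (c c' : S × ℕ) : Prop :=
  c.1 ∈ T ∧ ∃ i, M c.1 = some i ∧ c' = (i.next (c.2 % i.mod),
    i.mul (c.2 % i.mod) * (c.2 / i.mod) + i.add (c.2 % i.mod))

/-- The point of `C²` is in the state, and has the register content, that `c` prescribes. -/
def Represents (c : S × ℕ) (p : Cantor × Cantor) : Prop :=
  ∃ y, p = point (c.1, none) (ones c.2 zeros) (cons false y)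

theorem reflTransGen_carry {q : S} {i : Instr S} (hq : q ∈ T) (hi : M q = some i) (x y : Cantor)
    (k : ℕ) : Relation.ReflTransGen (Step {e | IsRule M T e})
      (point (q, none) (ones (i.mod * k) x) y) (point (q, none) x (ones k y)) := by
  induction k generalizing y with
  | zero => exact .refl
  | succ k ih =>
    refine Relation.ReflTransGen.head ⟨_, .carry hq hi, (ones (i.mod * k) x, y), ?_, rfl⟩ ?_
    · rw [carryRule_fst, ← ones_add, Nat.mul_succ, Nat.add_comm]
    · rw [carryRule_snd, ← ones_cons_true]
      exact ih _

theorem reflTransGen_expand {q : S} {i : Instr S} {r : ℕ} (hq : q ∈ T) (hi : M q = some i)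
    (hr : r < i.mod) (x y : Cantor) (k : ℕ) :
    Relation.ReflTransGen (Step {e | IsRule M T e}) (point (q, some r) x (ones k y))
      (point (q, some r) (ones (i.mul r * k) x) y) := by
  induction k generalizing x with
  | zero => exact .refl
  | succ k ih =>
    refine Relation.ReflTransGen.head ⟨_, .expand hq hi hr, (x, ones k y), rfl, rfl⟩ ?_
    rw [expandRule_snd, Nat.mul_succ, ones_add]
    exact ih _

/-- With register $mk+r$: $k$ carries, one exit, $k$ expansions and one finish. The number of steps
is positive, which is what makes an endless machine run give an endless run of the rules. -/
theorem Represents.exists_transGen {c c' : S × ℕ} {p : Cantor × Cantor} (hp : Represents c p)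
    (h : MachineStep M T c c') :
    ∃ p', Represents c' p' ∧ Relation.TransGen (Step {e | IsRule M T e}) p p' := by
  obtain ⟨y, rfl⟩ := hp
  obtain ⟨hq, i, hi, rfl⟩ := h
  have hr := Nat.mod_lt c.2 i.mod_pos
  have h1 := reflTransGen_carry hq hi (ones (c.2 % i.mod) zeros) (cons false y) (c.2 / i.mod)
  rw [← ones_add, Nat.div_add_mod] at h1
  have h2 : Step {e | IsRule M T e}
      (point (c.1, none) (ones (c.2 % i.mod) zeros) (ones (c.2 / i.mod) (cons false y)))
      (point (c.1, some (c.2 % i.mod)) zeros (ones (c.2 / i.mod) (cons false y))) := by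
    refine ⟨_, .exit hq hi hr, (zeros, ones (c.2 / i.mod) (cons false y)), ?_, ?_⟩
    · rw [exitRule_fst, cons_false_zeros]
    · rw [exitRule_snd, cons_false_zeros]
  have h3 := reflTransGen_expand hq hi hr zeros (cons false y) (c.2 / i.mod)
  refine ⟨_, ?_, ((Relation.TransGen.tail' h1 h2).trans_left h3).tail
    ⟨_, .finish hq hi hr, (ones (i.mul (c.2 % i.mod) * (c.2 / i.mod)) zeros, y), rfl, rfl⟩⟩
  rw [finishRule_snd, ← ones_add, Nat.add_comm]
  exact ⟨_, rfl⟩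

theorem Represents.exists_transGen_of_transGen {c c' : S × ℕ} {p : Cantor × Cantor}
    (hp : Represents c p) (h : Relation.TransGen (MachineStep M T) c c') :
    ∃ p', Represents c' p' ∧ Relation.TransGen (Step {e | IsRule M T e}) p p' := by
  induction h with
  | single h => exact hp.exists_transGen h
  | tail _ h ih =>
    obtain ⟨p', hp', h'⟩ := ih
    obtain ⟨p'', hp'', h''⟩ := hp'.exists_transGen h
    exact ⟨p'', hp'', h'.trans h''⟩

/-- A deterministic run that always returns to `I` after a positive number of steps never gets
stuck, not even between its visits to `I`. -/
theorem exists_rel_of_reflTransGen {α : Type*} {r : α → α → Prop}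
    (hdet : ∀ a b c, r a b → r a c → b = c) {I : α → Prop}
    (hI : ∀ a, I a → ∃ b, I b ∧ Relation.TransGen r a b) {a b : α} (ha : I a)
    (hab : Relation.ReflTransGen r a b) : ∃ c, r b c := by
  have key : ∃ c, I c ∧ Relation.TransGen r b c := by
    induction hab with
    | refl => exact hI a ha
    | @tail b c _ hbc ih =>
      obtain ⟨d, hd, hbd⟩ := ih
      obtain ⟨e, hbe, hed⟩ := Relation.TransGen.head'_iff.1 hbd
      obtain rfl := hdet _ _ _ hbc hbe
      obtain ⟨d', hd', hdd'⟩ := hI d hd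
      exact ⟨d', hd', Relation.TransGen.trans_right hed hdd'⟩
  obtain ⟨c, -, hbc⟩ := key
  obtain ⟨d, hbd, -⟩ := Relation.TransGen.head'_iff.1 hbc
  exact ⟨d, hbd⟩

theorem Step.unique {E : Set Rule} (hE : DisjointDomains E) {p q q' : Cantor × Cantor}
    (h : Step E p q) (h' : Step E p q') : q = q' := by
  obtain ⟨e, he, x, rfl, rfl⟩ := h
  obtain ⟨e', he', x', hx, rfl⟩ := h'
  obtain rfl := hE e he e' he' x x' hx
  rw [catPair_injective _ hx]

/-- An empty history distinguishes starting points: a carry leaves a 1 on top of the second stack,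
and a finish leaves 01, because every code begins with 1. -/
theorem not_step_point_zeros (q : S) (x : Cantor) (p : Cantor × Cantor) :
    ¬Step {e | IsRule M T e} p (point (q, none) x zeros) := by
  rintro ⟨e, he, z, -, h⟩
  cases he with
  | carry =>
    have h' : zeros = cons true z.2 := (point_inj h).2.2
    rw [← cons_false_zeros] at h'
    exact absurd (cons_inj h').1 (by simp)
  | exit => exact absurd (congrArg Prod.snd (point_inj (h.trans (exitRule_snd _ _ _))).1) (by simp)
  | expand =>
    exact absurd (congrArg Prod.snd (point_inj (h.trans (expandRule_snd _ _ _ _))).1) (by simp)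
  | finish =>
    have := (point_inj (h.trans (finishRule_snd _ _ _ _ _))).2.2
    rw [← cons_false_zeros, ← cons_false_zeros, cat_code] at this
    exact absurd (cons_inj (cons_inj this).2).1 (by simp)

theorem not_step_of_eq_none {q : S} (hq : M q = none) (x y : Cantor) (p : Cantor × Cantor) :
    ¬Step {e | IsRule M T e} (point (q, none) x y) p := by
  rintro ⟨e, he, z, h, -⟩
  cases he with
  | carry _ hi =>
    obtain rfl := congrArg Prod.fst (point_inj (h.trans (carryRule_fst _ _ _))).1
    simp [hq] at hi
  | exit _ hi =>
    obtain rfl := congrArg Prod.fst (point_inj (h.trans (exitRule_fst _ _ _))).1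
    simp [hq] at hi
  | expand => exact absurd (congrArg Prod.snd (point_inj h).1) (by simp)
  | finish => exact absurd (congrArg Prod.snd (point_inj h).1) (by simp)

/-- A machine with one register is simulated by an element of `2V`: whether the machine, started
with `n` in its register, halts is whether an orbit meets a certain rectangle. -/
theorem exists_mem_twoV_halting (M : S → Option (Instr S)) (T : Finset S) (q₀ qh : S)
    (hqh : M qh = none) : ∃ f ∈ TwoV,
      (∀ n m, Relation.ReflTransGen (MachineStep M T) (q₀, n) (qh, m) →
        (forwardOrbit f (tag true (point (q₀, none) (ones n zeros) zeros)) ∩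
          rect (true :: code (qh, (none : Option ℕ))) []).Nonempty) ∧
      ∀ n, ∀ I : S × ℕ → Prop, I (q₀, n) →
        (∀ c, I c → ∃ c', I c' ∧ Relation.TransGen (MachineStep M T) c c') →
        ¬(fullOrbit f (tag true (point (q₀, none) (ones n zeros) zeros)) ∩
          rect (true :: code (qh, (none : Option ℕ))) []).Nonempty := by
  obtain ⟨f, hf, h1, h2⟩ := exists_mem_twoV_simulating (finite_setOf_isRule (M := M) (T := T))
    disjointDomains_setOf_isRule disjointDomains_swap_setOf_isRule
  have hrep : ∀ n, Represents (q₀, n) (point (q₀, none) (ones n zeros) zeros) := fun n =>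
    ⟨zeros, by rw [cons_false_zeros]⟩
  refine ⟨f, hf, fun n m h => ?_, fun n I hI0 hI => ?_⟩
  · have h' : ∃ p, Represents (qh, m) p ∧ Relation.ReflTransGen (Step {e | IsRule M T e})
        (point (q₀, none) (ones n zeros) zeros) p := by
      rcases Relation.reflTransGen_iff_eq_or_transGen.1 h with h | h
      · exact ⟨_, h ▸ hrep n, .refl⟩
      · obtain ⟨p, hp, hp'⟩ := (hrep n).exists_transGen_of_transGen h
        exact ⟨p, hp, hp'.to_reflTransGen⟩
    obtain ⟨_, ⟨y, rfl⟩, hp⟩ := h'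
    refine ⟨tag true (point (qh, none) (ones m zeros) (cons false y)), ?_, ⟨_, rfl⟩, ⟨_, rfl⟩⟩
    generalize point (qh, none) (ones m zeros) (cons false y) = p at hp
    induction hp with
    | refl => exact ⟨0, rfl⟩
    | tail _ hst ih =>
      obtain ⟨k, hk⟩ := ih
      refine ⟨k + 1, ?_⟩
      rw [pow_succ', Homeomorph.mul_apply, ← hk, h1 _ _ hst]
  · rintro ⟨q, hq, hqR⟩
    obtain ⟨b, p, rfl, hp⟩ := h2 _ (fun ⟨p, hp⟩ => not_step_point_zeros _ _ p hp) q hq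
    obtain ⟨x, hx⟩ := (mem_rect_iff (w := (true :: code (qh, (none : Option ℕ)), []))).1 hqR
    have hx' : tag b p = tag true (point (qh, none) x.1 x.2) := hx
    obtain ⟨-, rfl⟩ := tag_inj hx'
    -- A reachable point in the rectangle would have a successor, although no rule applies in the
    -- halting state `qh`.
    obtain ⟨p', hp'⟩ := exists_rel_of_reflTransGen (r := Step {e | IsRule M T e})
      (fun _ _ _ => Step.unique disjointDomains_setOf_isRule)
      (I := fun p => ∃ c, I c ∧ Represents c p)
      (by
        rintro p ⟨c, hc, hcp⟩
        obtain ⟨c', hc', hcc'⟩ := hI c hc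
        obtain ⟨p', hp', hpp'⟩ := hcp.exists_transGen_of_transGen hcc'
        exact ⟨p', ⟨c', hc', hp'⟩, hpp'⟩)
      ⟨_, hI0, hrep n⟩ hp
    exact not_step_of_eq_none hqh _ _ _ hp'

end Machine

/-! ### Gödel numbering of the registers -/

/-- The contents of the registers of a counter machine. -/
abbrev Store : Type := ℕ →₀ ℕ

/-- The number whose prime factorization has the contents of the registers as exponents. -/
noncomputable def Store.number (s : Store) : ℕ := s.prod fun i k => Nat.nth Nat.Prime i ^ k

theorem Store.number_add (s t : Store) : (s + t).number = s.number * t.number :=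
  Finsupp.prod_add_index' (fun _ => pow_zero _) fun _ _ _ => pow_add _ _ _

theorem Store.number_single (i k : ℕ) :
    Store.number (Finsupp.single i k) = Nat.nth Nat.Prime i ^ k :=
  Finsupp.prod_single_index (pow_zero _)

theorem Store.number_update_succ (s : Store) (i k : ℕ) :
    Store.number (s.update i (k + 1)) = Nat.nth Nat.Prime i * Store.number (s.update i k) := by
  have : s.update i (k + 1) = Finsupp.single i 1 + s.update i k := by
    ext j
    by_cases h : j = i
    · subst h
      simp [Nat.add_comm]
    · simp [h]
  rw [this, Store.number_add, Store.number_single, pow_one]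

theorem Store.not_dvd_number {s : Store} {i : ℕ} (h : s i = 0) :
    ¬Nat.nth Nat.Prime i ∣ s.number := by
  intro hd
  obtain ⟨j, hj, hd⟩ := ((Nat.prime_nth_prime i).prime.dvd_finsetProd_iff _).1 hd
  have he := (Nat.prime_dvd_prime_iff_eq (Nat.prime_nth_prime i) (Nat.prime_nth_prime j)).1
    ((Nat.prime_nth_prime i).dvd_of_dvd_pow hd)
  obtain rfl := Nat.nth_injective Nat.infinite_setOfPred_prime he
  exact Finsupp.mem_support_iff.1 hj h

/-! ### Counter programs and their execution -/

/-- Programs for counter machines. The program `loop i P` is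
`while register i is not 0: decrease it and run P`. -/
inductive Prog : Type
  | skip : Prog
  | inc : ℕ → Prog
  | seq : Prog → Prog → Prog
  | loop : ℕ → Prog → Prog
  deriving Encodable, DecidableEq

namespace Prog

/-- The machine with one register that runs programs, and has lists of programs that remain to be
run as states. -/
noncomputable def machine : List Prog → Option (Instr (List Prog))
  | [] => none
  | skip :: K => some ⟨1, fun _ => 1, fun _ => 0, fun _ => K, one_pos, fun _ => one_pos⟩
  | inc i :: K => some ⟨1, fun _ => Nat.nth Nat.Prime i, fun _ => 0, fun _ => K, one_pos,
      fun _ => (Nat.prime_nth_prime i).pos⟩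
  | seq P Q :: K =>
    some ⟨1, fun _ => 1, fun _ => 0, fun _ => P :: Q :: K, one_pos, fun _ => one_pos⟩
  -- Remainder 0 modulo the `i`-th prime means that register `i` is positive; keeping the quotient
  -- then decreases it. Otherwise the number is restored from quotient and remainder.
  | loop i P :: K => some ⟨Nat.nth Nat.Prime i, fun r => if r = 0 then 1 else Nat.nth Nat.Prime i,
      fun r => r, fun r => if r = 0 then P :: loop i P :: K else K, (Nat.prime_nth_prime i).pos,
      fun r => by
        split
        · exact one_pos
        · exact (Nat.prime_nth_prime i).pos⟩

/-- The states that are passed when `P` is run, except the last one. -/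
def states : Prog → List Prog → Finset (List Prog)
  | skip, K => {skip :: K}
  | inc i, K => {inc i :: K}
  | seq P Q, K => insert (seq P Q :: K) (states P (Q :: K) ∪ states Q K)
  | loop i P, K => insert (loop i P :: K) (states P (loop i P :: K))

theorem cons_mem_states (P : Prog) (K : List Prog) : P :: K ∈ states P K := by
  cases P <;> simp [states]

/-- A run of the machine from `P :: K` to `K` that changes the store from `s` to `s'`. -/
def Exec (P : Prog) (s s' : Store) : Prop :=
  -- Arbitrary `K` allows sequential composition; arbitrary `T` lets all parts of a program run
  -- under one finite set of states, hence finitely many rules.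
  ∀ (K : List Prog) (T : Finset (List Prog)), states P K ⊆ T →
    Relation.TransGen (MachineStep machine T) (P :: K, s.number) (K, s'.number)

theorem exec_skip (s : Store) : Exec skip s s := fun K T hT =>
  .single ⟨hT (cons_mem_states _ _), _, rfl, by simp⟩

theorem exec_inc (i : ℕ) (s : Store) : Exec (inc i) s (s.update i (s i + 1)) := fun K T hT =>
  .single ⟨hT (cons_mem_states _ _), _, rfl, by
    rw [Store.number_update_succ, Finsupp.update_self]
    simp⟩

theorem Exec.seq {P Q : Prog} {s s' s'' : Store} (hP : Exec P s s') (hQ : Exec Q s' s'') :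
    Exec (seq P Q) s s'' := fun K T hT =>
  .head ⟨hT (cons_mem_states _ _), _, rfl, by simp⟩
    ((hP (Q :: K) T fun _ h => hT (by simp [states, h])).trans
      (hQ K T fun _ h => hT (by simp [states, h])))

theorem exec_loop_zero {i : ℕ} (P : Prog) {s : Store} (h : s i = 0) :
    Exec (Prog.loop i P) s s := fun K T hT =>
  .single ⟨hT (cons_mem_states _ _), _, rfl, by
    have := mt Nat.dvd_of_mod_eq_zero (Store.not_dvd_number h)
    simp only [this, if_false]
    rw [Nat.div_add_mod]⟩

/-- A single round, available also for loops that never end, to which `Exec` does not apply. -/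
theorem transGen_loop_succ {i : ℕ} {P : Prog} {s s' : Store} {k : ℕ} (hk : s i = k + 1)
    (hP : Exec P (s.update i k) s') {K : List Prog} {T : Finset (List Prog)}
    (hT : states (Prog.loop i P) K ⊆ T) :
    Relation.TransGen (MachineStep machine T) (Prog.loop i P :: K, s.number)
      (Prog.loop i P :: K, s'.number) := by
  refine .head ⟨hT (cons_mem_states _ _), _, rfl, rfl⟩ ?_
  have h : s.number = Nat.nth Nat.Prime i * Store.number (s.update i k) := by
    rw [← Store.number_update_succ, ← hk, Finsupp.update_self]
  simp only [h, Nat.mul_mod_right, if_true, one_mul, add_zero,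
    Nat.mul_div_cancel_left _ (Nat.prime_nth_prime i).pos]
  exact hP (Prog.loop i P :: K) T fun _ h => hT (by simp [states, h])

/-- The loop rule: the invariant is indexed by the number of rounds to go. -/
theorem exec_loop {i : ℕ} {P : Prog} (I : ℕ → Store → Prop) (h0 : ∀ k s, I k s → s i = k)
    (h1 : ∀ k s, I (k + 1) s → ∃ s', Exec P (s.update i k) s' ∧ I k s') (k : ℕ) (s : Store)
    (hs : I k s) : ∃ s', Exec (loop i P) s s' ∧ I 0 s' := by
  induction k generalizing s with
  | zero => exact ⟨s, exec_loop_zero P (h0 _ _ hs), hs⟩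
  | succ k ih =>
    obtain ⟨s', hs', hI⟩ := h1 k s hs
    obtain ⟨s'', hs'', hI'⟩ := ih s' hI
    exact ⟨s'', fun K T hT => (transGen_loop_succ (h0 _ _ hs) hs' hT).trans (hs'' K T hT), hI'⟩

/-- Set register `i` to 0. -/
def clear (i : ℕ) : Prog := loop i skip

theorem exec_clear (i : ℕ) (s : Store) :
    ∃ s', Exec (clear i) s s' ∧ s' i = 0 ∧ ∀ j, j ≠ i → s' j = s j := by
  refine exec_loop (fun k t => t i = k ∧ ∀ j, j ≠ i → t j = s j) (fun _ _ h => h.1)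
    (fun k t ht => ⟨_, exec_skip _, by simp, fun j hj => ?_⟩) (s i) s ⟨rfl, fun _ _ => rfl⟩
  simp [hj, ht.2 j hj]

/-- Copy register `a` to register `b`, with the help of register `t`. -/
def copy (a b t : ℕ) : Prog :=
  seq (clear b) (seq (clear t) (seq (loop a (seq (inc b) (inc t))) (loop t (inc a))))

theorem exec_copy {a b t : ℕ} (hab : a ≠ b) (hat : a ≠ t) (hbt : b ≠ t) (s : Store) :
    ∃ s', Exec (copy a b t) s s' ∧ s' b = s a ∧ ∀ j, j ≠ b → j ≠ t → s' j = s j := by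
  obtain ⟨s1, e1, z1, f1⟩ := exec_clear b s
  obtain ⟨s2, e2, z2, f2⟩ := exec_clear t s1
  obtain ⟨s3, e3, I3⟩ := exec_loop (i := a) (P := seq (inc b) (inc t))
    (fun k u => u a = k ∧ u b + k = s a ∧ u t + k = s a ∧
      ∀ j, j ≠ a → j ≠ b → j ≠ t → u j = s j) (fun _ _ h => h.1)
    (fun k u ⟨ha, hb, ht, hj⟩ => ⟨_, (exec_inc _ _).seq (exec_inc _ _), by
      simp [Function.update_apply, hab, hat], by
      simp [Function.update_apply, hab.symm, hbt]; omega, by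
      simp [Function.update_apply, hat.symm, hbt.symm]; omega, fun j h1 h2 h3 => by
      simp [Function.update_apply, h1, h2, h3, hj]⟩) (s a) s2
    ⟨by rw [f2 a hat, f1 a hab], by rw [f2 b hbt, z1, zero_add], by rw [z2, zero_add],
      fun j h1 h2 h3 => by rw [f2 j h3, f1 j h2]⟩
  obtain ⟨ha, hb, ht, hj⟩ := I3
  obtain ⟨s4, e4, I4⟩ := exec_loop (i := t) (P := inc a)
    (fun k u => u t = k ∧ u a + k = s a ∧ u b = s a ∧
      ∀ j, j ≠ a → j ≠ b → j ≠ t → u j = s j) (fun _ _ h => h.1)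
    (fun k u ⟨ht, ha, hb, hj⟩ => ⟨_, exec_inc _ _, by
      simp [Function.update_apply, hat.symm], by
      simp [hat]; omega, by
      simp [Function.update_apply, hab.symm, hbt, hb], fun j h1 h2 h3 => by
      simp [Function.update_apply, h1, h3, hj j h1 h2 h3]⟩) (s a) s3
    ⟨by simpa using ht, by rw [ha, zero_add], by simpa using hb, hj⟩
  refine ⟨s4, e1.seq (e2.seq (e3.seq e4)), I4.2.2.1, fun j h1 h2 => ?_⟩
  by_cases h : j = a
  · subst h
    simpa using I4.2.1
  · exact I4.2.2.2 j h h1 h2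

/-! ### Primitive recursive functions -/

/-- `P` computes the function `f` of the registers `idx` into register `out`, and apart from that
changes only registers from `m` on. -/
def Computes (P : Prog) {n : ℕ} (f : List.Vector ℕ n → ℕ) (idx : Fin n → ℕ) (out m : ℕ) : Prop :=
  ∀ s : Store, ∃ s', Exec P s s' ∧ s' out = f (List.Vector.ofFn fun i => s (idx i)) ∧
    ∀ j < m, j ≠ out → s' j = s j

/-- `f` is computed by programs, for any choice of registers. -/
def Computable {n : ℕ} (f : List.Vector ℕ n → ℕ) : Prop :=
  ∀ (idx : Fin n → ℕ) (out m : ℕ), (∀ i, idx i < m) → out < m → (∀ i, idx i ≠ out) →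
    ∃ P, Computes P f idx out m

theorem computable_zero : Computable (n := 0) fun _ => 0 := by
  intro idx out m _ _ _
  refine ⟨clear out, fun s => ?_⟩
  obtain ⟨s', e, z, h⟩ := exec_clear out s
  exact ⟨s', e, z, fun j _ hj => h j hj⟩

theorem computable_get {n : ℕ} (i : Fin n) : Computable fun v => v.get i := by
  intro idx out m hm ho hne
  refine ⟨copy (idx i) out m, fun s => ?_⟩
  obtain ⟨s', e, z, h⟩ := exec_copy (hne i) (hm i).ne ho.ne s
  exact ⟨s', e, by simp [z], fun j hj hj' => h j hj' hj.ne⟩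

theorem computable_succ : Computable (n := 1) fun v => v.head.succ := by
  intro idx out m hm ho hne
  refine ⟨seq (copy (idx 0) out m) (inc out), fun s => ?_⟩
  obtain ⟨s', e, z, h⟩ := exec_copy (hne 0) (hm 0).ne ho.ne s
  refine ⟨_, e.seq (exec_inc _ _), ?_, fun j hj hj' => ?_⟩
  · simpa using z
  · simp [hj', h j hj' hj.ne]

theorem Computable.comp {m n : ℕ} {f : List.Vector ℕ n → ℕ} {g : Fin n → List.Vector ℕ m → ℕ}
    (hf : Computable f) (hg : ∀ i, Computable (g i)) :
    Computable fun a => f (List.Vector.ofFn fun i => g i a) := by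
  intro idx out b hb ho hne
  have key : ∀ k ≤ n, ∃ P, ∀ s : Store, ∃ s', Exec P s s' ∧
      (∀ i : Fin n, i < k → s' (b + i) = g i (List.Vector.ofFn fun i => s (idx i))) ∧
      ∀ j < b, s' j = s j := by
    intro k
    induction k with
    | zero => exact fun _ => ⟨skip, fun s => ⟨s, exec_skip s, fun i hi => by simp at hi,
        fun _ _ => rfl⟩⟩
    | succ k ih =>
      intro hk
      obtain ⟨P, hP⟩ := ih (by omega)
      obtain ⟨Q, hQ⟩ := hg ⟨k, hk⟩ idx (b + k) (b + n) (fun i => (hb i).trans_le (by omega))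
        (by omega) (fun i => by have := hb i; omega)
      refine ⟨seq P Q, fun s => ?_⟩
      obtain ⟨s1, e1, v1, f1⟩ := hP s
      obtain ⟨s2, e2, v2, f2⟩ := hQ s1
      refine ⟨s2, e1.seq e2, fun i hi => ?_, fun j hj => ?_⟩
      · rcases (Nat.lt_succ_iff_lt_or_eq.1 hi) with h | h
        · rw [f2 _ (by omega) (by omega), v1 i h]
        · obtain rfl : i = ⟨k, hk⟩ := Fin.ext h
          simp only [v2, f1 _ (hb _)]
      · rw [f2 j (by omega) (by omega), f1 j hj]
  obtain ⟨P, hP⟩ := key n le_rfl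
  obtain ⟨Q, hQ⟩ := hf (fun i => b + i) out (b + n) (fun i => by omega) (by omega)
    (fun i => by omega)
  refine ⟨seq P Q, fun s => ?_⟩
  obtain ⟨s1, e1, v1, f1⟩ := hP s
  obtain ⟨s2, e2, v2, f2⟩ := hQ s1
  refine ⟨s2, e1.seq e2, ?_, fun j hj hj' => ?_⟩
  · rw [v2]
    simp only [v1 _ (Fin.is_lt _)]
  · rw [f2 j (by omega) hj', f1 j hj]

theorem Computable.prec {n : ℕ} {f : List.Vector ℕ n → ℕ} {g : List.Vector ℕ (n + 2) → ℕ}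
    (hf : Computable f) (hg : Computable g) :
    Computable fun v : List.Vector ℕ (n + 1) =>
      v.head.rec (f v.tail) fun y IH => g (y ::ᵥ IH ::ᵥ v.tail) := by
  intro idx out b hb ho hne
  obtain ⟨F, hF⟩ := hf (fun i => idx i.succ) out b (fun i => hb _) ho fun i => hne _
  -- Register `b` counts the rounds to go, `b + 1` holds the recursion index and `out` the value so
  -- far. As `G` must not write to one of its inputs, its result goes to `b + 2` and is copied to
  -- `out` with the help of `b + 3`.
  obtain ⟨G, hG⟩ := hg (Fin.cons (b + 1) (Fin.cons out fun i => idx i.succ)) (b + 2) (b + 3)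
    (Fin.cases (by simp) (Fin.cases (by simpa using by omega)
      fun i => by have := hb i.succ; simpa using by omega)) (by omega)
    (Fin.cases (by simp) (Fin.cases (by simpa using by omega)
      fun i => by have := hb i.succ; simpa using by omega))
  refine ⟨seq F (seq (copy (idx 0) b (b + 3)) (seq (clear (b + 1))
    (loop b (seq G (seq (copy (b + 2) out (b + 3)) (inc (b + 1))))))), fun s => ?_⟩
  set v : List.Vector ℕ n := List.Vector.ofFn fun i => s (idx i.succ) with hv
  have hb0 := hb 0
  obtain ⟨s1, e1, v1, f1⟩ := hF s
  obtain ⟨s2, e2, v2, f2⟩ := exec_copy (a := idx 0) (b := b) (t := b + 3) (by omega) (by omega)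
    (by omega) s1
  obtain ⟨s3, e3, v3, f3⟩ := exec_clear (b + 1) s2
  obtain ⟨s4, e4, I4⟩ := exec_loop (i := b)
    (P := seq G (seq (copy (b + 2) out (b + 3)) (inc (b + 1))))
    (fun k t => t b = k ∧ t (b + 1) + k = s (idx 0) ∧
      t out = (t (b + 1)).rec (f v) (fun y IH => g (y ::ᵥ IH ::ᵥ v)) ∧
      ∀ j < b, j ≠ out → t j = s j) (fun _ _ h => h.1)
    (by
      rintro k t ⟨h1, h2, h3, h4⟩
      obtain ⟨t1, e1, v1, f1⟩ := hG (t.update b k)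
      obtain ⟨t2, e2, v2, f2⟩ := exec_copy (a := b + 2) (b := out) (t := b + 3) (by omega)
        (by omega) (by omega) t1
      have hv' : (List.Vector.ofFn fun i : Fin n => (t.update b k) (idx i.succ)) = v := by
        rw [hv]
        congr 1
        funext i
        have := (hb i.succ).ne
        simp [this, h4 _ (hb i.succ) (hne i.succ)]
      have hv1 : t1 (b + 2) = g (t (b + 1) ::ᵥ t out ::ᵥ v) := by
        rw [v1, ← hv']
        have h5 : (t.update b k) (b + 1) = t (b + 1) := by simp
        have h6 : (t.update b k) out = t out := by simp [ho.ne]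
        rw [← h5, ← h6]
        rfl
      have hb1 : t2 (b + 1) = t (b + 1) := by
        rw [f2 _ (by omega) (by omega), f1 _ (by omega) (by omega)]
        simp
      refine ⟨_, e1.seq (e2.seq (exec_inc _ _)), ?_, ?_, ?_, fun j hj hj' => ?_⟩
      · simp only [Finsupp.coe_update, Function.update_apply]
        rw [if_neg (by omega), f2 _ (by omega) (by omega), f1 _ (by omega) (by omega)]
        simp
      · simp only [Finsupp.coe_update, Function.update_self]
        omega
      · simp only [Finsupp.coe_update, Function.update_self]
        rw [Function.update_apply, if_neg (by omega), v2, hv1, hb1, h3]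
      · simp only [Finsupp.coe_update, Function.update_apply]
        rw [if_neg (by omega), f2 _ (by omega) (by omega), f1 _ (by omega) (by omega)]
        simp [hj.ne, h4 j hj hj'])
    (s (idx 0)) s3
    ⟨by rw [f3 _ (by omega), v2, f1 _ hb0 (hne 0)], by rw [v3, zero_add], by
      rw [v3, f3 _ (by omega), f2 _ (by omega) (by omega), v1]
      rfl, fun j hj hj' => by
      rw [f3 _ (by omega), f2 _ (by omega) (by omega), f1 _ hj hj']⟩
  refine ⟨s4, e1.seq (e2.seq (e3.seq e4)), ?_, I4.2.2.2⟩
  have h5 : s4 (b + 1) = s (idx 0) := I4.2.1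
  rw [I4.2.2.1, h5]
  rfl

theorem computable_of_primrec' {n : ℕ} {f : List.Vector ℕ n → ℕ} (hf : Nat.Primrec' f) :
    Computable f := by
  induction hf with
  | zero => exact computable_zero
  | succ => exact computable_succ
  | get i => exact computable_get i
  | comp g _ _ hf hg => exact hf.comp hg
  | prec _ _ hf hg => exact hf.prec hg

/-! ### Unbounded search -/

/-- Unbounded search: a machine with one register that, started with `2ⁿ`, halts if and only if the
primitive recursive function `g n` has a zero. -/
theorem exists_search {g : ℕ → ℕ → ℕ} (hg : Primrec₂ g) :
    ∃ (T : Finset (List Prog)) (q : List Prog),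
    ∀ n, ((∃ k, g n k = 0) → ∃ m, Relation.ReflTransGen (MachineStep machine T)
        (q, Nat.nth Nat.Prime 0 ^ n) ([], m)) ∧
      ((¬∃ k, g n k = 0) → ∃ I : List Prog × ℕ → Prop, I (q, Nat.nth Nat.Prime 0 ^ n) ∧
        ∀ c, I c → ∃ c', I c' ∧ Relation.TransGen (MachineStep machine T) c c') := by
  -- Register 0 holds `n`, register 1 the candidate, register 2 the value of `g`; scratch space
  -- starts at 3.
  obtain ⟨G, hG⟩ := computable_of_primrec' (Nat.Primrec'.prim_iff₂.2 hg) ![0, 1] 2 3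
    (by simp [Fin.forall_fin_two]) (by omega) (by simp [Fin.forall_fin_two])
  have hG' : ∀ s : Store, ∃ s', Exec G s s' ∧ s' 2 = g (s 0) (s 1) ∧ s' 0 = s 0 ∧ s' 1 = s 1 := by
    intro s
    obtain ⟨s', e, v, h⟩ := hG s
    exact ⟨s', e, v, h 0 (by omega) (by omega), h 1 (by omega) (by omega)⟩
  -- The body overwrites the loop register with the next value of `g`, so the loop ends only when a
  -- zero is found.
  set L : Prog := loop 2 (seq (inc 1) G) with hL
  set T := states (seq G L) [] with hT
  have hTL : states L [] ⊆ T := fun _ h => by simp [hT, states, h]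
  have hTG : states G [L] ⊆ T := fun _ h => by simp [hT, states, h]
  refine ⟨T, [seq G L], fun n => ?_⟩
  have hn : Nat.nth Nat.Prime 0 ^ n = Store.number (Finsupp.single 0 n) :=
    (Store.number_single 0 n).symm
  rw [hn]
  let J : ℕ → Store → Prop := fun j s => s 0 = n ∧ s 1 = j ∧ s 2 = g n j
  have hstart : ∃ s, J 0 s ∧ Relation.TransGen (MachineStep machine T)
      ([seq G L], Store.number (Finsupp.single 0 n)) ([L], s.number) := by
    obtain ⟨s, e, h2, h0, h1⟩ := hG' (Finsupp.single 0 n)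
    refine ⟨s, ⟨by simp [h0], by simp [h1], by simp [h2]⟩, ?_⟩
    exact .head ⟨cons_mem_states _ _, _, rfl, by simp⟩ (e [L] T hTG)
  have hround : ∀ j s, J j s → g n j ≠ 0 → ∃ s', J (j + 1) s' ∧
      Relation.TransGen (MachineStep machine T) ([L], s.number) ([L], s'.number) := by
    rintro j s ⟨h0, h1, h2⟩ hne
    obtain ⟨k, hk⟩ := Nat.exists_eq_succ_of_ne_zero hne
    obtain ⟨s', e, h2', h0', h1'⟩ := hG' ((s.update 2 k).update 1 (j + 1))
    have e' : Exec (seq (inc 1) G) (s.update 2 k) s' := by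
      have h := exec_inc 1 (s.update 2 k)
      have h3 : (s.update 2 k) 1 = j := by simpa [Function.update_apply] using h1
      rw [h3] at h
      exact h.seq e
    refine ⟨s', ⟨?_, ?_, ?_⟩, transGen_loop_succ (h2.trans hk) e' hTL⟩
    · simpa [Function.update_apply, h0'] using h0
    · simp [h1']
    · simp [h2', h0]
  constructor
  · rintro ⟨k, hk⟩
    have key : ∀ d j s, j + d = k → J j s → ∃ m, Relation.ReflTransGen (MachineStep machine T)
        ([L], s.number) ([], m) := by
      intro d
      induction d with
      | zero =>
        rintro j s rfl ⟨-, -, h2⟩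
        exact ⟨_, (exec_loop_zero _ (h2.trans hk) [] T hTL).to_reflTransGen⟩
      | succ d ih =>
        rintro j s hj hs
        by_cases hz : g n j = 0
        · exact ⟨_, (exec_loop_zero _ (hs.2.2.trans hz) [] T hTL).to_reflTransGen⟩
        · obtain ⟨s', hs', h⟩ := hround j s hs hz
          obtain ⟨m, hm⟩ := ih (j + 1) s' (by omega) hs'
          exact ⟨m, h.to_reflTransGen.trans hm⟩
    obtain ⟨s, hs, h⟩ := hstart
    obtain ⟨m, hm⟩ := key k 0 s (by omega) hs
    exact ⟨m, h.to_reflTransGen.trans hm⟩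
  · intro hno
    -- The invariant consists of the start and the visits to the head of the loop.
    refine ⟨fun c => c = ([seq G L], Store.number (Finsupp.single 0 n)) ∨
      ∃ j s, J j s ∧ c = ([L], s.number), Or.inl rfl, ?_⟩
    rintro _ (rfl | ⟨j, s, hs, rfl⟩)
    · obtain ⟨s, hs, h⟩ := hstart
      exact ⟨_, Or.inr ⟨0, s, hs, rfl⟩, h⟩
    · obtain ⟨s', hs', h⟩ := hround j s hs fun hz => hno ⟨j, hz⟩
      exact ⟨_, Or.inr ⟨j + 1, s', hs', rfl⟩, h⟩

end Prog

/-! ### Reduction from the halting problem -/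

/-- Evaluation with a bound `k` is primitive recursive, and a program halts on input 0 exactly when
some bound suffices. -/
theorem exists_primrec_zero_iff_dom : ∃ g : ℕ → ℕ → ℕ, Primrec₂ g ∧
    ∀ c : Nat.Partrec.Code, (∃ k, g (Encodable.encode c) k = 0) ↔ (c.eval 0).Dom := by
  refine ⟨fun m k => bif (Nat.Partrec.Code.evaln k (Denumerable.ofNat Nat.Partrec.Code m) 0).isSome
    then 0 else 1, ?_, fun c => ?_⟩
  · refine Primrec.cond (Primrec.option_isSome.comp (Nat.Partrec.Code.primrec_evaln.comp
      (Primrec.pair (Primrec.pair Primrec.snd ((Primrec.ofNat _).comp Primrec.fst))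
        (Primrec.const 0)))) (Primrec.const 0) (Primrec.const 1)
  · simp only [Part.dom_iff_mem, Nat.Partrec.Code.evaln_complete, Denumerable.ofNat_encode]
    rw [exists_comm]
    refine exists_congr fun k => ?_
    cases Nat.Partrec.Code.evaln k c 0 <;> simp

theorem not_isDecidable_of_halting {Q : Input → Prop} (x : ℕ → Input) (c : ℕ → InputCode)
    (hc : Computable c) (hx : ∀ n, IsCodeOf (c n) (x n))
    (hQ : ∀ a : Nat.Partrec.Code, Q (x (Encodable.encode a)) ↔ (a.eval 0).Dom) :
    ¬IsDecidable Q := by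
  classical
  rintro ⟨d, hd, h⟩
  refine ComputablePred.halting_problem 0 (ComputablePred.computable_iff.2
    ⟨fun a => decide (a.eval 0).Dom, ?_, by simp⟩)
  refine (hd.comp (hc.comp Computable.encode)).of_eq fun a => ?_
  obtain ⟨b, hb, hbQ⟩ := h _ _ (hx (Encodable.encode a))
  rw [hQ] at hbQ
  have : b = decide (a.eval 0).Dom := by
    rw [Bool.eq_iff_iff, hbQ, decide_eq_true_iff]
  subst this
  exact Part.eq_some_iff.2 hb

theorem finite_setOf_cat_zeros (u : Word) : {n | cat u zeros n = true}.Finite := by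
  refine (Set.finite_lt_nat u.length).subset fun n hn => ?_
  by_contra hlt
  obtain ⟨k, rfl⟩ := Nat.exists_eq_add_of_le' (not_lt.1 hlt)
  rw [Set.mem_ofPred_eq, cat_add_length] at hn
  exact Bool.false_ne_true hn

theorem primrec_replicate_pow (m : ℕ) : Primrec fun n : ℕ => List.replicate (m ^ n) true := by
  have hpow : Primrec fun n : ℕ => m ^ n :=
    (Primrec₂.unpaired'.1 Nat.Primrec.pow).comp (Primrec.const m) Primrec.id
  refine (Primrec.list_map (Primrec.list_range.comp hpow)
    (Primrec.const true).to₂).of_eq fun n => ?_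
  rw [List.map_const', List.length_range]

/-- There are an element `f` of `2V`, a sequence of dyadic points and a dyadic rectangle such that
the orbits of the points meet the rectangle if and only if the corresponding program halts. -/
theorem exists_inputs_halting : ∃ (x : ℕ → Input) (c : ℕ → InputCode), Computable c ∧
    (∀ n, IsCodeOf (c n) (x n)) ∧ ∀ a : Nat.Partrec.Code,
      ((a.eval 0).Dom →
        (forwardOrbit (x (Encodable.encode a)).f (x (Encodable.encode a)).p ∩
          (x (Encodable.encode a)).R).Nonempty) ∧
      ((fullOrbit (x (Encodable.encode a)).f (x (Encodable.encode a)).p ∩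
          (x (Encodable.encode a)).R).Nonempty → (a.eval 0).Dom) := by
  obtain ⟨g, hg, hgdom⟩ := exists_primrec_zero_iff_dom
  obtain ⟨T, q, hq⟩ := Prog.exists_search hg
  obtain ⟨f, hf, h1, h2⟩ := exists_mem_twoV_halting Prog.machine T q [] rfl
  -- As `f` does not depend on `n`, mere existence of `P` is enough: it enters the codes as a
  -- constant, and only the word for the point has to be computed.
  obtain ⟨P, hP⟩ := exists_isPatternPairFor hf
  set m := Nat.nth Nat.Prime 0
  let u : ℕ → Word := fun n => true :: code (q, (none : Option ℕ)) ++ List.replicate (m ^ n) true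
  have hu : ∀ n, tag true (point (q, none) (ones (m ^ n) zeros) zeros) =
      (cat (u n) zeros, cat [] zeros) := fun n => Prod.ext
    (cat_append (true :: code (q, (none : Option ℕ))) (List.replicate (m ^ n) true) zeros).symm rfl
  refine ⟨fun n => ⟨f, tag true (point (q, none) (ones (m ^ n) zeros) zeros), _, hf, ?_,
      ⟨true :: code (([] : List Prog), (none : Option ℕ)), [], rfl⟩⟩,
    fun n => (P, (u n, []), (true :: code (([] : List Prog), (none : Option ℕ)), [])), ?_,
    fun n => ⟨hP, hu n, rfl⟩, fun a => ⟨fun ha => ?_, fun ha => ?_⟩⟩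
  · rw [hu]
    exact ⟨finite_setOf_cat_zeros _, finite_setOf_cat_zeros _⟩
  · exact (Primrec.pair (Primrec.const P) (Primrec.pair (Primrec.pair (Primrec.list_append.comp
      (Primrec.const _) (primrec_replicate_pow m)) (Primrec.const [])) (Primrec.const _))).to_comp
  · obtain ⟨k, hk⟩ := (hq _).1 ((hgdom a).2 ha)
    exact h1 _ k hk
  · by_contra hno
    obtain ⟨I, hI0, hI⟩ := (hq (Encodable.encode a)).2 fun hz => hno ((hgdom a).1 hz)
    exact h2 _ I hI0 hI ha

theorem forwardOrbit_subset_fullOrbit (f : (Cantor × Cantor) ≃ₜ (Cantor × Cantor))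
    (p : Cantor × Cantor) : forwardOrbit f p ⊆ fullOrbit f p := by
  rintro _ ⟨n, rfl⟩
  exact ⟨n, by rw [zpow_natCast]⟩

end BrinThompson

theorem mainTheorem7 :
    ¬ BrinThompson.IsDecidable
        (fun x => (BrinThompson.forwardOrbit x.f x.p ∩ x.R).Nonempty) ∧
    ¬ BrinThompson.IsDecidable
        (fun x => (BrinThompson.fullOrbit x.f x.p ∩ x.R).Nonempty) := by
  obtain ⟨x, c, hc, hx, h⟩ := BrinThompson.exists_inputs_halting
  have hsub : ∀ y : BrinThompson.Input, (BrinThompson.forwardOrbit y.f y.p ∩ y.R).Nonempty →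
      (BrinThompson.fullOrbit y.f y.p ∩ y.R).Nonempty := fun y =>
    Set.Nonempty.mono (Set.inter_subset_inter_left _
      (BrinThompson.forwardOrbit_subset_fullOrbit _ _))
  -- Halting implies meeting in the forward orbit, hence in the full orbit, which in turn implies
  -- halting; so all three are equivalent.
  exact ⟨BrinThompson.not_isDecidable_of_halting x c hc hx fun a =>
      ⟨fun ha => (h a).2 (hsub _ ha), (h a).1⟩,
    BrinThompson.not_isDecidable_of_halting x c hc hx fun a =>
      ⟨(h a).2, fun ha => hsub _ ((h a).1 ha)⟩⟩
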